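/- Throughout, a space is a simplicial set, weak equivalences are those of the Kan–Quillen model structure, and homotopy limits are formed in it. A simplicial space is a simplicial object $X=(X_n)_{n\ge 0}$ in spaces. It is a Segal space if for each $n\ge 2$ the map $$X_n \xrightarrow{(\alpha_0^*,\dots,\alpha_{n-1}^*)} \operatorname{holim}\bigl(X_1 \xrightarrow{d_0} X_0 \xleftarrow{d_1} X_1 \xrightarrow{d_0} \cdots \xleftarrow{d_1} X_1\bigr)$$ (with $n$ copies of $X_1$) is a weak equivalence, where $\alpha_i:[1]\to[n]$ sends $0<1$ to $i<i+1$. No fibrancy conditions are imposed. Let $f : X\to B$ be a map of simplicial spaces, where $B$ is a Segal space, and suppose that the square $$\begin{array}{ccc} X_0 & \xleftarrow{d_1} & X_1\\ \downarrow & & \downarrow\\ B_0 & \xleftarrow{d_1} & B_1\end{array}$$ is homotopy cartesian. Then the following statements are equivalent. 1. $X$ is a Segal space (that is, $X\to B$ is a right fibration: $X$ is a Segal space and the above square is homotopy cartesian). 2. For each $n\ge 1$, the square $$\begin{array}{ccc} X_0 & \xleftarrow{a_n^*} & X_n\\ \downarrow & & \downarrow\\ B_0 & \xleftarrow{a_n^*}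 & B_n\end{array}$$ is homotopy cartesian, where $a_n:[0]\to[n]$ is the map sending $0$ to $0$. 3. For each $n\ge 1$, the square $$\begin{array}{ccc} X_{n-1} & \xleftarrow{d_n} & X_n\\ \downarrow & & \downarrow\\ B_{n-1} & \xleftarrow{d_n} & B_n\end{array}$$ is homotopy cartesian, where $d_n$ is induced by the map $d^n:[n-1]\to[n]$ which misses $n$. -/

import Mathlib

open CategoryTheory CategoryTheory.Limits Simplicial

universe u

namespace SimplicialSpace

/-- A map `f : X ⟶ Y` of simplicial sets is a weak equivalence (in the Kan–Quillen sense) if for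
every Kan complex `K`, precomposition with `f` is a bijection from homotopy classes of maps
`Y ⟶ K` to homotopy classes of maps `X ⟶ K`. (For maps into a Kan complex, being related by a
simplicial homotopy `X ⊗ Δ[1] ⟶ K` is an equivalence relation.) -/
def IsWeakEquivalence {X Y : SSet.{u}} (f : X ⟶ Y) : Prop :=
  ∀ (K : SSet.{u}) [SSet.KanComplex K],
    (∀ g : X ⟶ K, ∃ h : Y ⟶ K, Nonempty (SSet.Homotopy (f ≫ h) g)) ∧
    (∀ h h' : Y ⟶ K, Nonempty (SSet.Homotopy (f ≫ h) (f ≫ h')) →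
      Nonempty (SSet.Homotopy h h'))

section HomotopyLimits

variable {J : Type} [SmallCategory J]

/-- A diagram of simplicial sets is injectively fibrant if maps into it extend along all
natural transformations that are objectwise monomorphisms and weak equivalences, i.e. if it is
fibrant for the injective model structure on diagrams. -/
def IsInjectivelyFibrant (F : J ⥤ SSet.{u}) : Prop :=
  ∀ ⦃A B : J ⥤ SSet.{u}⦄ (i : A ⟶ B), (∀ j, Mono (i.app j)) →
    (∀ j, IsWeakEquivalence (i.app j)) → ∀ g : A ⟶ F, ∃ h : B ⟶ F, i ≫ h = g

/-- A cone `c` over a diagram `F` of simplicial sets is a homotopy limit cone if the canonical map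
`c.pt ⟶ holim F` is a weak equivalence. Here `holim F` is the limit of an injectively fibrant
diagram `F'` which receives an objectwise weak equivalence `η : F ⟶ F'`, and the canonical map
is the one induced by the composites `c.pt ⟶ F j ⟶ F' j`. -/
def IsHomotopyLimit {F : J ⥤ SSet.{u}} (c : Cone F) : Prop :=
  ∃ (F' : J ⥤ SSet.{u}) (η : F ⟶ F') (t : Cone F') (ht : IsLimit t),
    IsInjectivelyFibrant F' ∧ (∀ j, IsWeakEquivalence (η.app j)) ∧
      IsWeakEquivalence (ht.lift ((Cone.postcompose η).obj c))

end HomotopyLimits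

/-- A commutative square of simplicial sets is homotopy cartesian if the map from its initial
corner to the homotopy limit of the remaining cospan is a weak equivalence. -/
def IsHomotopyCartesian {W X Y Z : SSet.{u}} {t : W ⟶ X} {l : W ⟶ Y} {r : X ⟶ Z} {b : Y ⟶ Z}
    (sq : CommSq t l r b) : Prop :=
  IsHomotopyLimit (PullbackCone.mk t l sq.w)

/-- For a map `f : X ⟶ B` of simplicial spaces and an operator `φ : ⦋m⦌ ⟶ ⦋n⦌`, the naturality
square with top `φ^* : X_n ⟶ X_m` and bottom `φ^* : B_n ⟶ B_m` is homotopy cartesian. -/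
def IsHomotopyCartesianAlong {X B : SimplicialObject SSet.{u}} (f : X ⟶ B)
    {m n : SimplexCategory} (φ : m ⟶ n) : Prop :=
  IsHomotopyCartesian (CommSq.mk (f.naturality φ.op))

/-- The shape of the zigzag diagram `• ⟶ • ⟵ • ⟶ • ⟵ ⋯ ⟵ •` with `k + 1` sources and `k`
targets: the `i`-th target receives arrows from the `i`-th and the `(i + 1)`-st source. -/
abbrev zigzagShape (k : ℕ) : MulticospanShape.{0, 0} where
  L := Fin (k + 1)
  R := Fin k
  fst := Fin.castSucc
  snd := Fin.succ

/-- The diagram `X₁ ⟶ X₀ ⟵ X₁ ⟶ ⋯ ⟵ X₁` with `k + 1` copies of `X₁`, in which the arrows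
to the right are `d₀` and the arrows to the left are `d₁`. -/
abbrev segalDiagram (X : SimplicialObject SSet.{u}) (k : ℕ) :
    MulticospanIndex (zigzagShape k) SSet.{u} where
  left _ := X _⦋1⦌
  right _ := X _⦋0⦌
  fst _ := X.δ 0
  snd _ := X.δ 1

theorem segal_comm (X : SimplicialObject SSet.{u}) (k : ℕ) (b : Fin k) :
    X.map (SimplexCategory.mkOfSucc b.castSucc).op ≫ X.δ 0 =
      X.map (SimplexCategory.mkOfSucc b.succ).op ≫ X.δ 1 := by
  rw [SimplicialObject.δ, SimplicialObject.δ, ← X.map_comp, ← X.map_comp, ← op_comp, ← op_comp,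
    SimplexCategory.δ_zero_mkOfSucc, SimplexCategory.δ_one_mkOfSucc, Fin.succ_castSucc]

/-- The cone `(α₀^*, …, α_k^*)` from `X_{k+1}` to the Segal diagram, where
`α_i = mkOfSucc i : ⦋1⦌ ⟶ ⦋k+1⦌` sends `0 < 1` to `i < i + 1`. -/
def segalCone (X : SimplicialObject SSet.{u}) (k : ℕ) : Multifork (segalDiagram X k) :=
  Multifork.ofι (segalDiagram X k) (X _⦋k + 1⦌)
    (fun i => X.map (SimplexCategory.mkOfSucc (n := k + 1) i).op)
    (segal_comm X k)

/-- A Segal space: a simplicial space `X` such that for each `n ≥ 2` the Segal map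
`X_n ⟶ holim (X₁ ⟶ X₀ ⟵ X₁ ⟶ ⋯ ⟵ X₁)`, with `n` copies of `X₁`, is a weak equivalence.
Here `n = k + 1`. -/
def IsSegal (X : SimplicialObject SSet.{u}) : Prop :=
  ∀ k : ℕ, 1 ≤ k → IsHomotopyLimit (segalCone X k)

/-- A map `f : X ⟶ B` with `B` a Segal space is a right fibration if `X` is a Segal space and the
square of target maps `d₁` is homotopy cartesian. -/
def IsRightFibration {X B : SimplicialObject SSet.{u}} (f : X ⟶ B) : Prop :=
  IsSegal X ∧ IsHomotopyCartesianAlong f (SimplexCategory.δ (n := 0) 1)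

end SimplicialSpace

/-! The Segal condition presents `X_n` as the `n`-fold homotopy fibre product `X₁ ×_{X₀} ⋯ ×_{X₀}
X₁`, whose projection to the first vertex is a composite of base changes of the source map `d₁`. By
hypothesis `X₁ ≃ X₀ ×_{B₀} B₁` via the source. By induction on the number of factors, the whole
product for `X` is therefore the homotopy pullback along `X₀ ⟶ B₀` of the product for `B`, which is
`B_n` because `B` is Segal. So the Segal map of `X` in degree `n` is a weak equivalence exactly when
`X_n ≃ X₀ ×_{B₀} B_n`, degree by degree. The conditions on first vertices and on last faces are
linked by the factorization of `a_{n+1}` as `a_n` followed by `d^{n+1}` and the pasting law.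

To work with strict limits, `X₁ ⇉ X₀` is replaced by a Kan fibration `E ⟶ Z × Z` with `Z` Kan
(`SourceTargetModel`). The resulting zigzag is injectively fibrant (`isInjectivelyFibrant_chain`),
its limit is an iterated pullback, and the induction is
`ChainLimit.isWeakEquivalence_of_isPullback`.

Weak equivalences are tested by maps into Kan complexes, so the homotopy theory is derived from
anodyne extensions. Fibrations between Kan complexes that are weak equivalences are trivial, weak
equivalences between Kan complexes are stable under base change along fibrations, and homotopy
limits do not depend on the fibrant replacement (`isHomotopyLimit_iff`). -/

namespace SimplicialSpace

/-! ### Cylinders and homotopy lifting -/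

section Cylinders

open MonoidalCategory CartesianMonoidalCategory HomotopicalAlgebra SSet SSet.modelCategoryQuillen

/-- The pushout-product of a monomorphism with an anodyne extension is anodyne. The lifting problem
is unpacked here into its component maps. -/
theorem exists_lift_pushoutProduct {A B C D E Z : SSet.{u}} (i : A ⟶ B) [Mono i] (j : C ⟶ D)
    (hj : anodyneExtensions j) (p : E ⟶ Z) [Fibration p] (b : B ⊗ C ⟶ E) (a : A ⊗ D ⟶ E)
    (z : B ⊗ D ⟶ Z) (hab : i ▷ C ≫ b = A ◁ j ≫ a) (hb : b ≫ p = B ◁ j ≫ z)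
    (ha : a ≫ p = i ▷ D ≫ z) :
    ∃ l : B ⊗ D ⟶ E, B ◁ j ≫ l = b ∧ i ▷ D ≫ l = a ∧ l ≫ p = z := by
  let sq₁₂ := Functor.PushoutObjObj.ofHasPushout (curriedTensor SSet.{u}) i j
  have hl : HasLiftingProperty sq₁₂.ι p :=
    anodyneExtensions_pushoutObjObjι sq₁₂ hj _ (mem_fibrations p)
  have sq : CommSq (sq₁₂.isPushout.desc b a hab) sq₁₂.ι p z :=
    ⟨sq₁₂.isPushout.hom_ext (by simpa using hb) (by simpa using ha)⟩
  refine ⟨sq.lift, ?_, ?_, sq.fac_right⟩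
  · have := sq₁₂.inl ≫= sq.fac_left
    rw [IsPushout.inl_desc, sq₁₂.inl_ι_assoc] at this
    exact this
  · have := sq₁₂.inr ≫= sq.fac_left
    rw [IsPushout.inr_desc, sq₁₂.inr_ι_assoc] at this
    exact this

/-- The vertex `e` of the interval. -/
noncomputable abbrev vertex (e : Fin 2) : Δ[1] _⦋0⦌ := stdSimplex.obj₀Equiv.{u}.symm e

/-- The inclusion of the end `e` of the cylinder; this is `ι₀` for `e = 0` and `ι₁` for
`e = 1`. -/
noncomputable abbrev cylEnd (e : Fin 2) {X : SSet.{u}} : X ⟶ X ⊗ Δ[1] :=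
  CartesianMonoidalCategory.lift (𝟙 X) (SSet.const (vertex e))

theorem cylEnd_whiskerRight (e : Fin 2) {X Y : SSet.{u}} (f : X ⟶ Y) :
    cylEnd e ≫ f ▷ Δ[1] = f ≫ cylEnd e := rfl

theorem anodyne_vertex (e : Fin 2) :
    anodyneExtensions (SSet.const (vertex.{u} e) : Δ[0] ⟶ Δ[1]) := by
  have key (i j : Fin 2) (hij : j ≠ i) :
      anodyneExtensions (stdSimplex.δ j : (Δ[0] : SSet.{u}) ⟶ Δ[1]) := by
    intro E Z p hp
    have : Fibration p := by rwa [HomotopicalAlgebra.fibration_iff]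
    refine ⟨fun {f g} sq ↦ ?_⟩
    -- A horn in `Δ[1]` has a single face, so compatibility of the faces is vacuous.
    obtain ⟨φ, h₁, h₂⟩ := horn.IsCompatible.exists_lift (n := 0) (i := i) (f := fun _ _ ↦ f)
      trivial p g (fun k hk ↦ by
        obtain rfl : k = j := by omega
        exact sq.w)
    exact ⟨⟨⟨φ, h₁ j hij, h₂⟩⟩⟩
  fin_cases e
  · exact stdSimplex.δ_one_eq_const.{u} ▸ key 0 1 (by simp)
  · exact stdSimplex.δ_zero_eq_const.{u} ▸ key 1 0 (by simp)

theorem fst_cylEnd (e : Fin 2) (X : SSet.{u}) :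
    fst X Δ[0] ≫ cylEnd e = X ◁ (SSet.const (vertex e) : Δ[0] ⟶ Δ[1]) := rfl

theorem lift_fst_stdSimplex_zero (X : SSet.{u}) (x : Δ[0] _⦋0⦌) :
    fst X Δ[0] ≫ CartesianMonoidalCategory.lift (𝟙 X) (SSet.const x) = 𝟙 _ := by
  apply CartesianMonoidalCategory.hom_ext
  · simp
  · exact stdSimplex.ext₀

theorem anodyne_cylEnd (e : Fin 2) (X : SSet.{u}) :
    anodyneExtensions (cylEnd e : X ⟶ X ⊗ Δ[1]) := by
  have h := (anodyne_vertex.{u} e).whiskerLeft X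
  rw [← fst_cylEnd] at h
  have : IsIso (fst X Δ[0]) := ⟨CartesianMonoidalCategory.lift (𝟙 X)
    (SSet.const (stdSimplex.obj₀Equiv.symm 0)), lift_fst_stdSimplex_zero X _, rfl⟩
  exact (anodyneExtensions.cancel_left_of_respectsIso _ _).1 h

/-- The relative homotopy lifting property of Kan fibrations. -/
theorem exists_homotopy_lift (e : Fin 2) {A B E Z : SSet.{u}} (i : A ⟶ B) [Mono i] (p : E ⟶ Z)
    [Fibration p] (b : B ⟶ E) (a : A ⊗ Δ[1] ⟶ E) (z : B ⊗ Δ[1] ⟶ Z)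
    (hab : cylEnd e ≫ a = i ≫ b) (hb : cylEnd e ≫ z = b ≫ p) (ha : a ≫ p = i ▷ Δ[1] ≫ z) :
    ∃ l : B ⊗ Δ[1] ⟶ E, cylEnd e ≫ l = b ∧ i ▷ Δ[1] ≫ l = a ∧ l ≫ p = z := by
  obtain ⟨l, h₁, h₂, h₃⟩ := exists_lift_pushoutProduct i
    (SSet.const (vertex.{u} e) : Δ[0] ⟶ Δ[1]) (anodyne_vertex e) p (fst _ _ ≫ b) a z
    (by rw [← fst_cylEnd, Category.assoc, hab]; simp)
    (by rw [← fst_cylEnd, Category.assoc, Category.assoc, hb]) ha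
  refine ⟨l, ?_, h₂, h₃⟩
  rw [← fst_cylEnd, Category.assoc] at h₁
  have := CartesianMonoidalCategory.lift (𝟙 B)
    (SSet.const (stdSimplex.obj₀Equiv.{u}.symm 0) : B ⟶ Δ[0]) ≫= h₁
  simpa only [lift_fst_assoc, Category.id_comp] using this

/-- The inclusion of both ends of the cylinder. -/
noncomputable def cylEnds (X : SSet.{u}) : X ⨿ X ⟶ X ⊗ Δ[1] :=
  coprod.desc (cylEnd 0) (cylEnd 1)

theorem exists_desc_cylinder_coprod {X Y K E : SSet.{u}} (l : X ⊗ K ⟶ E) (m : Y ⊗ K ⟶ E) :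
    ∃ a : (X ⨿ Y) ⊗ K ⟶ E, coprod.inl ▷ K ≫ a = l ∧ coprod.inr ▷ K ≫ a = m := by
  obtain ⟨a, ha₀, ha₁⟩ := BinaryCofan.IsColimit.desc'
    (mapIsColimitOfPreservesOfIsColimit (tensorRight K) _ _ (coprodIsCoprod X Y)) l m
  exact ⟨a, ha₀, ha₁⟩

theorem cylinder_coprod_hom_ext {X Y K E : SSet.{u}} {a b : (X ⨿ Y) ⊗ K ⟶ E}
    (hl : coprod.inl ▷ K ≫ a = coprod.inl ▷ K ≫ b)
    (hr : coprod.inr ▷ K ≫ a = coprod.inr ▷ K ≫ b) : a = b :=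
  BinaryCofan.IsColimit.hom_ext
    (mapIsColimitOfPreservesOfIsColimit (tensorRight K) _ _ (coprodIsCoprod X Y)) hl hr

@[simp]
theorem inl_cylEnds (X : SSet.{u}) : coprod.inl ≫ cylEnds X = cylEnd 0 :=
  coprod.inl_desc _ _

@[simp]
theorem inr_cylEnds (X : SSet.{u}) : coprod.inr ≫ cylEnds X = cylEnd 1 :=
  coprod.inr_desc _ _

theorem coprod_jointly_surjective {X Y : SSet.{u}} {n : SimplexCategoryᵒᵖ} (z : (X ⨿ Y).obj n) :
    (∃ x : X.obj n, (coprod.inl : X ⟶ X ⨿ Y).app n x = z) ∨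
      ∃ y : Y.obj n, (coprod.inr : Y ⟶ X ⨿ Y).app n y = z := by
  obtain ⟨⟨_ | _⟩, y, hy⟩ := Types.jointly_surjective_of_isColimit
    (isColimitOfPreserves ((evaluation _ _).obj n) (colimit.isColimit (pair X Y))) z
  exacts [Or.inl ⟨y, hy⟩, Or.inr ⟨y, hy⟩]

/-- Each end is injective, and the two are disjoint because the constant simplices at `0` and `1` of
the interval differ in every degree. -/
instance mono_cylEnds (X : SSet.{u}) : Mono (cylEnds X) := by
  have h₀ {n : SimplexCategoryᵒᵖ} (x : X.obj n) :
      (cylEnds X).app n ((coprod.inl : X ⟶ X ⨿ X).app n x) = (cylEnd 0 : X ⟶ _).app n x :=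
    ConcreteCategory.congr_hom (congr_app (inl_cylEnds X) n) x
  have h₁ {n : SimplexCategoryᵒᵖ} (x : X.obj n) :
      (cylEnds X).app n ((coprod.inr : X ⟶ X ⨿ X).app n x) = (cylEnd 1 : X ⟶ _).app n x :=
    ConcreteCategory.congr_hom (congr_app (inr_cylEnds X) n) x
  have h₂ {n : SimplexCategoryᵒᵖ} (x y : X.obj n) :
      (cylEnd 0 : X ⟶ _).app n x ≠ (cylEnd 1 : X ⟶ _).app n y := by
    induction n using Opposite.rec with | op n
    induction n using SimplexCategory.rec with | _ k
    intro h
    have h' : ((cylEnd 0 : X ⟶ _).app _ x).2 (0 : Fin (k + 1)) =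
      ((cylEnd 1 : X ⟶ _).app _ y).2 (0 : Fin (k + 1)) := by rw [h]
    exact Fin.zero_ne_one h'
  rw [NatTrans.mono_iff_mono_app]
  intro n
  rw [mono_iff_injective]
  intro z w hzw
  obtain ⟨x, rfl⟩ | ⟨x, rfl⟩ := coprod_jointly_surjective z <;>
    obtain ⟨y, rfl⟩ | ⟨y, rfl⟩ := coprod_jointly_surjective w
  · rw [h₀, h₀] at hzw
    rw [show x = y from congr_arg Prod.fst hzw]
  · rw [h₀, h₁] at hzw
    exact (h₂ _ _ hzw).elim
  · rw [h₀, h₁] at hzw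
    exact (h₂ _ _ hzw.symm).elim
  · rw [h₁, h₁] at hzw
    rw [show x = y from congr_arg Prod.fst hzw]

/-- Filling a square in the total space of a Kan fibration, given three of its sides. -/
theorem exists_square_lift {X E Z : SSet.{u}} (p : E ⟶ Z) [Fibration p]
    (b l m : X ⊗ Δ[1] ⟶ E) (z : (X ⊗ Δ[1]) ⊗ Δ[1] ⟶ Z)
    (hl : cylEnd 0 ≫ l = cylEnd 0 ≫ b) (hm : cylEnd 0 ≫ m = cylEnd 1 ≫ b)
    (hb : b ≫ p = cylEnd 0 ≫ z) (hlp : l ≫ p = cylEnd 0 ▷ Δ[1] ≫ z)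
    (hmp : m ≫ p = cylEnd 1 ▷ Δ[1] ≫ z) :
    ∃ s : (X ⊗ Δ[1]) ⊗ Δ[1] ⟶ E, cylEnd 0 ≫ s = b ∧ cylEnd 0 ▷ Δ[1] ≫ s = l ∧
      cylEnd 1 ▷ Δ[1] ≫ s = m ∧ s ≫ p = z := by
  obtain ⟨a, ha₀, ha₁⟩ := exists_desc_cylinder_coprod l m
  obtain ⟨s, h₁, h₂, h₃⟩ := exists_homotopy_lift 0 (cylEnds X) p b a z
    (by
      apply coprod.hom_ext
      · rw [← reassoc_of% (cylEnd_whiskerRight 0 (coprod.inl : X ⟶ X ⨿ X)), ha₀, hl,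
          reassoc_of% (inl_cylEnds X)]
      · rw [← reassoc_of% (cylEnd_whiskerRight 0 (coprod.inr : X ⟶ X ⨿ X)), ha₁, hm,
          reassoc_of% (inr_cylEnds X)])
    hb.symm
    (by
      apply cylinder_coprod_hom_ext
      · rw [reassoc_of% ha₀, hlp, ← comp_whiskerRight_assoc, inl_cylEnds]
      · rw [reassoc_of% ha₁, hmp, ← comp_whiskerRight_assoc, inr_cylEnds])
  refine ⟨s, h₁, ?_, ?_, h₃⟩
  · rw [← ha₀, ← h₂, ← comp_whiskerRight_assoc, inl_cylEnds]
  · rw [← ha₁, ← h₂, ← comp_whiskerRight_assoc, inr_cylEnds]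

/-- The pointwise maximum on the interval. -/
noncomputable def intervalMax : (Δ[1] ⊗ Δ[1] : SSet.{u}) ⟶ Δ[1] where
  app _ := ↾fun x ↦ stdSimplex.objEquiv.symm (SimplexCategory.Hom.mk
    ((stdSimplex.objEquiv x.1).toOrderHom ⊔ (stdSimplex.objEquiv x.2).toOrderHom))
  naturality _ _ _ := rfl

end Cylinders

/-! ### Homotopy classes of maps and weak equivalences -/

section WeakEquivalences

open MonoidalCategory CartesianMonoidalCategory HomotopicalAlgebra SSet SSet.modelCategoryQuillen

/-- Two maps are homotopic if there is a simplicial homotopy from the first to the second. -/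
def Homotopic {X Y : SSet.{u}} (f g : X ⟶ Y) : Prop :=
  ∃ h : X ⊗ Δ[1] ⟶ Y, cylEnd 0 ≫ h = f ∧ cylEnd 1 ≫ h = g

theorem nonempty_homotopy_iff {X Y : SSet.{u}} {f g : X ⟶ Y} :
    Nonempty (SSet.Homotopy f g) ↔ Homotopic f g := by
  constructor
  · rintro ⟨H⟩
    exact ⟨H.h, H.h₀, H.h₁⟩
  · rintro ⟨h, h₀, h₁⟩
    -- What remains is a condition on the empty subcomplex.
    refine ⟨⟨h, h₀, h₁, ?_⟩⟩
    ext n ⟨⟨x, hx⟩, _⟩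
    exact hx.elim

theorem Homotopic.refl {X Y : SSet.{u}} (f : X ⟶ Y) : Homotopic f f :=
  ⟨fst _ _ ≫ f, by simp, by simp⟩

theorem Homotopic.comp_left {X Y Z : SSet.{u}} (f : X ⟶ Y) {g g' : Y ⟶ Z} (h : Homotopic g g') :
    Homotopic (f ≫ g) (f ≫ g') := by
  obtain ⟨h, rfl, rfl⟩ := h
  exact ⟨f ▷ _ ≫ h, rfl, rfl⟩

theorem Homotopic.comp_right {X Y Z : SSet.{u}} {f f' : X ⟶ Y} (h : Homotopic f f') (g : Y ⟶ Z) :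
    Homotopic (f ≫ g) (f' ≫ g) := by
  obtain ⟨h, rfl, rfl⟩ := h
  exact ⟨h ≫ g, by simp, by simp⟩

/-- The two homotopies and the constant one at `h` form three sides of a square, and the fourth side
of a filling is the result. Symmetry and transitivity both follow from this one case. -/
theorem Homotopic.trans_of_left {X K : SSet.{u}} [KanComplex K] {f g h : X ⟶ K}
    (hfg : Homotopic f g) (hfh : Homotopic f h) : Homotopic g h := by
  obtain ⟨l, hl₀, hl₁⟩ := hfg
  obtain ⟨b, hb₀, hb₁⟩ := hfh
  obtain ⟨s, -, h₂, h₃, -⟩ := exists_square_lift (terminal.from K) b l (fst _ _ ≫ h)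
    (terminal.from _) (by rw [hl₀, hb₀]) (by rw [hb₁]; simp) (by subsingleton) (by subsingleton)
    (by subsingleton)
  refine ⟨cylEnd 1 ≫ s, ?_, ?_⟩
  · rw [← reassoc_of% (cylEnd_whiskerRight 1 (cylEnd 0 : X ⟶ _)), h₂, hl₁]
  · rw [← reassoc_of% (cylEnd_whiskerRight 1 (cylEnd 1 : X ⟶ _)), h₃, lift_fst_assoc,
      Category.id_comp]

theorem Homotopic.symm {X K : SSet.{u}} [KanComplex K] {f g : X ⟶ K} (h : Homotopic f g) :
    Homotopic g f :=
  h.trans_of_left (.refl f)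

theorem Homotopic.trans {X K : SSet.{u}} [KanComplex K] {f g h : X ⟶ K} (hfg : Homotopic f g)
    (hgh : Homotopic g h) : Homotopic f h :=
  hfg.symm.trans_of_left hgh

/-- The setoid of homotopy of maps to a Kan complex. -/
def homotopySetoid (X K : SSet.{u}) [KanComplex K] : Setoid (X ⟶ K) where
  r := Homotopic
  iseqv := ⟨.refl, .symm, .trans⟩

/-- The set of homotopy classes of maps to a Kan complex. -/
def HoMaps (X K : SSet.{u}) [KanComplex K] : Type u := Quotient (homotopySetoid X K)

/-- Precomposition on homotopy classes of maps to a Kan complex. -/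
def precompHoMaps {X Y : SSet.{u}} (f : X ⟶ Y) (K : SSet.{u}) [KanComplex K] :
    HoMaps Y K → HoMaps X K :=
  Quotient.map (f ≫ ·) fun _ _ h ↦ Homotopic.comp_left f h

/-- This reduces the cancellation properties of weak equivalences to those of bijections. -/
theorem isWeakEquivalence_iff {X Y : SSet.{u}} {f : X ⟶ Y} :
    IsWeakEquivalence f ↔
      ∀ (K : SSet.{u}) [KanComplex K], Function.Bijective (precompHoMaps f K) := by
  simp only [IsWeakEquivalence, nonempty_homotopy_iff]
  refine forall₂_congr fun K _ ↦ and_comm.trans (and_congr ?_ ?_)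
  · constructor
    · rintro h ⟨a⟩ ⟨b⟩ hab
      exact Quotient.sound (h a b (Quotient.exact hab))
    · intro h a b hab
      exact Quotient.exact (@h ⟦a⟧ ⟦b⟧ (Quotient.sound hab))
  · constructor
    · rintro h ⟨g⟩
      obtain ⟨a, ha⟩ := h g
      exact ⟨⟦a⟧, Quotient.sound ha⟩
    · intro h g
      obtain ⟨⟨a⟩, ha⟩ := h ⟦g⟧
      exact ⟨a, Quotient.exact ha⟩

theorem precompHoMaps_comp {X Y Z : SSet.{u}} (f : X ⟶ Y) (g : Y ⟶ Z) (K : SSet.{u})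
    [KanComplex K] : precompHoMaps (f ≫ g) K = precompHoMaps f K ∘ precompHoMaps g K := by
  ext ⟨a⟩
  exact congr_arg (Quotient.mk _) (Category.assoc _ _ _)

theorem precompHoMaps_id (X K : SSet.{u}) [KanComplex K] : precompHoMaps (𝟙 X) K = id := by
  ext ⟨a⟩
  exact congr_arg (Quotient.mk _) (Category.id_comp _)

theorem Homotopic.precompHoMaps_eq {X Y : SSet.{u}} {f g : X ⟶ Y} (h : Homotopic f g)
    (K : SSet.{u}) [KanComplex K] : precompHoMaps f K = precompHoMaps g K := by
  ext ⟨a⟩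
  exact Quotient.sound (h.comp_right a)

theorem Homotopic.isWeakEquivalence_iff {X Y : SSet.{u}} {f g : X ⟶ Y} (h : Homotopic f g) :
    IsWeakEquivalence f ↔ IsWeakEquivalence g := by
  simp only [SimplicialSpace.isWeakEquivalence_iff]
  exact forall₂_congr fun K _ ↦ by rw [h.precompHoMaps_eq K]

theorem IsWeakEquivalence.id (X : SSet.{u}) : IsWeakEquivalence (𝟙 X) := by
  rw [isWeakEquivalence_iff]
  intro K _
  rw [precompHoMaps_id]
  exact Function.bijective_id

theorem IsWeakEquivalence.comp {X Y Z : SSet.{u}} {f : X ⟶ Y} {g : Y ⟶ Z}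
    (hf : IsWeakEquivalence f) (hg : IsWeakEquivalence g) : IsWeakEquivalence (f ≫ g) := by
  rw [isWeakEquivalence_iff] at *
  intro K _
  rw [precompHoMaps_comp]
  exact (hf K).comp (hg K)

theorem IsWeakEquivalence.comp_iff_right {X Y Z : SSet.{u}} {f : X ⟶ Y} (g : Y ⟶ Z)
    (hf : IsWeakEquivalence f) : IsWeakEquivalence (f ≫ g) ↔ IsWeakEquivalence g := by
  refine ⟨fun h ↦ ?_, hf.comp⟩
  rw [isWeakEquivalence_iff] at *
  intro K _
  have := h K
  rw [precompHoMaps_comp] at this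
  exact (Function.Bijective.of_comp_iff' (hf K) _).1 this

theorem IsWeakEquivalence.comp_iff_left {X Y Z : SSet.{u}} (f : X ⟶ Y) {g : Y ⟶ Z}
    (hg : IsWeakEquivalence g) : IsWeakEquivalence (f ≫ g) ↔ IsWeakEquivalence f := by
  refine ⟨fun h ↦ ?_, fun h ↦ h.comp hg⟩
  rw [isWeakEquivalence_iff] at *
  intro K _
  have := h K
  rw [precompHoMaps_comp] at this
  exact (Function.Bijective.of_comp_iff _ (hg K)).1 this

/-- The two-out-of-six property. -/
theorem IsWeakEquivalence.of_comp_of_comp {W X Y Z : SSet.{u}} {f : W ⟶ X} {g : X ⟶ Y} {h : Y ⟶ Z}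
    (hfg : IsWeakEquivalence (f ≫ g)) (hgh : IsWeakEquivalence (g ≫ h)) :
    IsWeakEquivalence f := by
  rw [isWeakEquivalence_iff] at *
  intro K _
  have h₁ := hfg K
  have h₂ := hgh K
  rw [precompHoMaps_comp] at h₁ h₂
  have hg : Function.Bijective (precompHoMaps g K) := ⟨h₁.1.of_comp, h₂.2.of_comp⟩
  exact (Function.Bijective.of_comp_iff _ hg).1 h₁

theorem IsWeakEquivalence.of_isIso {X Y : SSet.{u}} (f : X ⟶ Y) [IsIso f] :
    IsWeakEquivalence f :=
  IsWeakEquivalence.of_comp_of_comp (g := inv f) (h := f) (by simpa using .id X)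
    (by simpa using .id Y)

theorem IsWeakEquivalence.of_homotopyInverse {X Y : SSet.{u}} {f : X ⟶ Y} {g : Y ⟶ X}
    (hfg : IsWeakEquivalence (f ≫ g)) (hgf : IsWeakEquivalence (g ≫ f)) : IsWeakEquivalence f :=
  .of_comp_of_comp hfg hgf

theorem exists_lift_of_anodyne {A B E Z : SSet.{u}} {i : A ⟶ B} (hi : anodyneExtensions i)
    (p : E ⟶ Z) [Fibration p] {a : A ⟶ E} {b : B ⟶ Z} (h : a ≫ p = i ≫ b) :
    ∃ l : B ⟶ E, i ≫ l = a ∧ l ≫ p = b := by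
  have := hi p (mem_fibrations p)
  have sq : CommSq a i p b := ⟨h⟩
  exact ⟨sq.lift, sq.fac_left, sq.fac_right⟩

theorem exists_extension_of_anodyne {A B K : SSet.{u}} {i : A ⟶ B} (hi : anodyneExtensions i)
    [KanComplex K] (a : A ⟶ K) : ∃ l : B ⟶ K, i ≫ l = a := by
  obtain ⟨l, hl, -⟩ := exists_lift_of_anodyne hi (terminal.from K) (a := a)
    (b := terminal.from B) (by subsingleton)
  exact ⟨l, hl⟩

/-- Every map factors as an anodyne extension followed by a Kan fibration. -/
theorem exists_anodyne_fibration_factorization {X Y : SSet.{u}} (f : X ⟶ Y) :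
    ∃ (E : SSet.{u}) (i : X ⟶ E) (p : E ⟶ Y),
      anodyneExtensions i ∧ Fibration p ∧ i ≫ p = f := by
  obtain ⟨d⟩ := MorphismProperty.HasFactorization.nonempty_mapFactorizationData
    (W₁ := modelCategoryQuillen.J.{u}.rlp.llp) (W₂ := modelCategoryQuillen.J.{u}.rlp) f
  exact ⟨d.Z, d.i, d.p, d.hi, by rw [fibration_iff]; exact d.hp, d.fac⟩

theorem exists_anodyne_kanComplex (X : SSet.{u}) :
    ∃ (K : SSet.{u}) (i : X ⟶ K), KanComplex K ∧ anodyneExtensions i := by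
  obtain ⟨K, i, p, hi, hp, -⟩ := exists_anodyne_fibration_factorization (terminal.from X)
  refine ⟨K, i, ?_, hi⟩
  rw [KanComplex, isFibrant_iff, Subsingleton.elim (terminal.from K) p]
  exact hp

theorem mono_of_anodyne {A B : SSet.{u}} {i : A ⟶ B} (hi : anodyneExtensions i) : Mono i := by
  rw [anodyneExtensions_eq_retracts_transfiniteCompositions] at hi
  have h : (MorphismProperty.transfiniteCompositions.{u} (MorphismProperty.coproducts.{u}
      modelCategoryQuillen.J.{u}).pushouts).retracts ≤ MorphismProperty.monomorphisms SSet.{u} := by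
    rw [MorphismProperty.retracts_le_iff, MorphismProperty.transfiniteCompositions_le_iff,
      MorphismProperty.pushouts_le_iff, MorphismProperty.coproducts_le_iff]
    exact J_le_monomorphisms
  exact h _ hi

/-- Homotopies extend along anodyne extensions, with prescribed ends. -/
theorem exists_homotopy_extension_of_anodyne {A B K : SSet.{u}} {i : A ⟶ B}
    (hi : anodyneExtensions i) [KanComplex K] (h h' : B ⟶ K) (H : A ⊗ Δ[1] ⟶ K)
    (hH : cylEnd 0 ≫ H = i ≫ h) (hH' : cylEnd 1 ≫ H = i ≫ h') :
    ∃ L : B ⊗ Δ[1] ⟶ K, cylEnd 0 ≫ L = h ∧ cylEnd 1 ≫ L = h' ∧ i ▷ Δ[1] ≫ L = H := by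
  let pt : Δ[0] _⦋0⦌ := stdSimplex.obj₀Equiv.{u}.symm 0
  -- The pushout-product lemma takes the anodyne map in the right factor, so the interval is moved
  -- to the left, in the form `Δ[0] ⊗ Δ[1]`, to use `cylEnds Δ[0]` as the monomorphism.
  let φ (X : SSet.{u}) : (Δ[0] ⊗ Δ[1]) ⊗ X ⟶ X ⊗ Δ[1] :=
    CartesianMonoidalCategory.lift (snd _ _) (fst _ _ ≫ snd _ _)
  let ψ (X : SSet.{u}) : X ⊗ Δ[1] ⟶ (Δ[0] ⊗ Δ[1]) ⊗ X :=
    CartesianMonoidalCategory.lift (CartesianMonoidalCategory.lift (SSet.const pt) (snd _ _))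
      (fst _ _)
  obtain ⟨a, ha₀, ha₁⟩ := exists_desc_cylinder_coprod (X := Δ[0]) (Y := Δ[0]) (snd _ B ≫ h)
    (snd _ B ≫ h')
  have hφ₀ (X : SSet.{u}) : cylEnd 0 ▷ X ≫ φ X = snd Δ[0] X ≫ cylEnd 0 := rfl
  have hφ₁ (X : SSet.{u}) : cylEnd 1 ▷ X ≫ φ X = snd Δ[0] X ≫ cylEnd 1 := rfl
  have hψ₀ : cylEnd 0 ≫ ψ B = CartesianMonoidalCategory.lift (SSet.const pt) (𝟙 B) ≫
    cylEnd 0 ▷ B := rfl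
  have hψ₁ : cylEnd 1 ≫ ψ B = CartesianMonoidalCategory.lift (SSet.const pt) (𝟙 B) ≫
    cylEnd 1 ▷ B := rfl
  have hψ₂ : i ▷ Δ[1] ≫ ψ B = ψ A ≫ (Δ[0] ⊗ Δ[1]) ◁ i := rfl
  have hψφ : ψ A ≫ φ A = 𝟙 _ := rfl
  obtain ⟨L, h₁, h₂, -⟩ := exists_lift_pushoutProduct (cylEnds Δ[0]) i hi (terminal.from K)
    (φ A ≫ H) a (terminal.from _)
    (by
      apply cylinder_coprod_hom_ext
      · rw [← comp_whiskerRight_assoc, inl_cylEnds, reassoc_of% (hφ₀ A), hH,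
          ← whisker_exchange_assoc, ha₀, whiskerLeft_snd_assoc]
      · rw [← comp_whiskerRight_assoc, inr_cylEnds, reassoc_of% (hφ₁ A), hH',
          ← whisker_exchange_assoc, ha₁, whiskerLeft_snd_assoc])
    (by subsingleton) (by subsingleton)
  refine ⟨ψ B ≫ L, ?_, ?_, ?_⟩
  · rw [reassoc_of% hψ₀, ← inl_cylEnds, comp_whiskerRight_assoc, h₂, ha₀, lift_snd_assoc,
      Category.id_comp]
  · rw [reassoc_of% hψ₁, ← inr_cylEnds, comp_whiskerRight_assoc, h₂, ha₁, lift_snd_assoc,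
      Category.id_comp]
  · rw [reassoc_of% hψ₂, h₁, reassoc_of% hψφ]

theorem isWeakEquivalence_of_anodyne {A B : SSet.{u}} {i : A ⟶ B} (hi : anodyneExtensions i) :
    IsWeakEquivalence i := by
  intro K _
  simp only [nonempty_homotopy_iff]
  refine ⟨fun g ↦ ?_, fun h h' ⟨H, H₀, H₁⟩ ↦ ?_⟩
  · obtain ⟨l, rfl⟩ := exists_extension_of_anodyne hi g
    exact ⟨l, .refl _⟩
  · obtain ⟨L, h₀, h₁, -⟩ := exists_homotopy_extension_of_anodyne hi h h' H H₀ H₁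
    exact ⟨L, h₀, h₁⟩

end WeakEquivalences

/-! ### Trivial fibrations and acyclic fibrations between Kan complexes -/

section TrivialFibrations

open MonoidalCategory CartesianMonoidalCategory HomotopicalAlgebra SSet SSet.modelCategoryQuillen

/-- A trivial fibration is a map with the right lifting property against monomorphisms. -/
def IsTrivialFibration {E Z : SSet.{u}} (p : E ⟶ Z) : Prop :=
  (MorphismProperty.monomorphisms SSet.{u}).rlp p

theorem IsTrivialFibration.exists_lift {A B E Z : SSet.{u}} {p : E ⟶ Z}
    (hp : IsTrivialFibration p) (i : A ⟶ B) [Mono i] {a : A ⟶ E} {b : B ⟶ Z}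
    (h : a ≫ p = i ≫ b) : ∃ l : B ⟶ E, i ≫ l = a ∧ l ≫ p = b := by
  have := hp i (MorphismProperty.monomorphisms.infer_property i)
  have sq : CommSq a i p b := ⟨h⟩
  exact ⟨sq.lift, sq.fac_left, sq.fac_right⟩

/-- Lifting against `∅ ⟶ Z` gives a section `s`, and lifting against the two ends of the cylinder
gives a homotopy from `p ≫ s` to the identity. -/
theorem IsTrivialFibration.isWeakEquivalence {E Z : SSet.{u}} {p : E ⟶ Z}
    (hp : IsTrivialFibration p) : IsWeakEquivalence p := by
  obtain ⟨s, -, hs⟩ := hp.exists_lift (initial.to Z) (a := initial.to E) (b := 𝟙 Z)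
    (by subsingleton)
  obtain ⟨H, hH, -⟩ := hp.exists_lift (cylEnds E) (a := coprod.desc (p ≫ s) (𝟙 E))
    (b := fst _ _ ≫ p) (by
      apply coprod.hom_ext
      · rw [coprod.inl_desc_assoc, reassoc_of% (inl_cylEnds E), lift_fst_assoc, Category.assoc, hs,
          Category.comp_id, Category.id_comp]
      · rw [coprod.inr_desc_assoc, reassoc_of% (inr_cylEnds E), lift_fst_assoc])
  have h : Homotopic (p ≫ s) (𝟙 E) := by
    refine ⟨H, ?_, ?_⟩
    · rw [← inl_cylEnds, Category.assoc, hH, coprod.inl_desc]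
    · rw [← inr_cylEnds, Category.assoc, hH, coprod.inr_desc]
  exact .of_homotopyInverse (h.isWeakEquivalence_iff.2 (.id E)) (hs ▸ .id Z)

/-- The contraction of a square onto one of its sides, by pointwise maximum. -/
noncomputable def cylMax (X : SSet.{u}) : (X ⊗ Δ[1]) ⊗ Δ[1] ⟶ X ⊗ Δ[1] :=
  (α_ X Δ[1] Δ[1]).hom ≫ X ◁ intervalMax

theorem cylEnd_zero_cylMax (X : SSet.{u}) : cylEnd 0 ≫ cylMax X = 𝟙 _ := by
  apply CartesianMonoidalCategory.hom_ext
  · rfl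
  · ext n ⟨x, t⟩
    apply stdSimplex.objEquiv.injective
    ext k
    exact congr_arg Fin.val (sup_bot_eq (stdSimplex.objEquiv t k))

theorem cylEnd_zero_whiskerRight_cylMax (X : SSet.{u}) : cylEnd 0 ▷ Δ[1] ≫ cylMax X = 𝟙 _ := by
  apply CartesianMonoidalCategory.hom_ext
  · rfl
  · ext n ⟨x, t⟩
    apply stdSimplex.objEquiv.injective
    ext k
    exact congr_arg Fin.val (bot_sup_eq (stdSimplex.objEquiv t k))

theorem cylEnd_one_cylMax (X : SSet.{u}) :
    cylEnd 1 ≫ cylMax X = fst _ _ ≫ cylEnd 1 := by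
  apply CartesianMonoidalCategory.hom_ext
  · rfl
  · ext n ⟨x, t⟩
    apply stdSimplex.objEquiv.injective
    ext k
    exact congr_arg Fin.val (sup_top_eq (stdSimplex.objEquiv t k))

theorem cylEnd_one_whiskerRight_cylMax (X : SSet.{u}) :
    cylEnd 1 ▷ Δ[1] ≫ cylMax X = fst _ _ ≫ cylEnd 1 := by
  apply CartesianMonoidalCategory.hom_ext
  · rfl
  · ext n ⟨x, t⟩
    apply stdSimplex.objEquiv.injective
    ext k
    exact congr_arg Fin.val (top_sup_eq (stdSimplex.objEquiv t k))

/-- A Kan fibration between Kan complexes which is a weak equivalence is a strong deformation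
retraction, fibrewise over the base. -/
theorem exists_section_of_isWeakEquivalence {E Z : SSet.{u}} (p : E ⟶ Z) [Fibration p]
    [KanComplex E] [KanComplex Z] (hp : IsWeakEquivalence p) :
    ∃ (s : Z ⟶ E) (H : E ⊗ Δ[1] ⟶ E), s ≫ p = 𝟙 Z ∧ cylEnd 0 ≫ H = p ≫ s ∧
      cylEnd 1 ≫ H = 𝟙 E ∧ H ≫ p = fst _ _ ≫ p := by
  simp only [IsWeakEquivalence, nonempty_homotopy_iff] at hp
  -- Testing on `E` and `Z` gives a homotopy inverse `s₀`. Lifting the homotopy from `s₀ ≫ p` to `𝟙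
  -- Z` turns it into a strict section.
  obtain ⟨s₀, hs₀⟩ := (hp E).1 (𝟙 E)
  obtain ⟨K, hK₀, hK₁⟩ := (hp Z).2 (s₀ ≫ p) (𝟙 Z) (by simpa using hs₀.comp_right p)
  obtain ⟨L, hL, hLp⟩ := exists_lift_of_anodyne (anodyne_cylEnd 0 Z) p hK₀.symm
  have hs : (cylEnd 1 ≫ L) ≫ p = 𝟙 Z := by rw [Category.assoc, hLp, hK₁]
  have hs' : Homotopic s₀ (cylEnd 1 ≫ L) := ⟨L, hL, rfl⟩
  generalize cylEnd 1 ≫ L = s at hs hs'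
  obtain ⟨H, hH₀, hH₁⟩ := (hs'.comp_left p).symm.trans hs₀
  -- The homotopy `H` need not be fibrewise. The square with sides `H`, `H ≫ p ≫ s` and a constant
  -- homotopy is filled over `cylMax E ≫ H ≫ p`, which is constant on the fourth side, so that side
  -- is a fibrewise homotopy.
  obtain ⟨S, -, hS₀, hS₁, hSp⟩ := exists_square_lift p H (H ≫ p ≫ s) (fst _ _)
    (cylMax E ≫ H ≫ p) (by rw [reassoc_of% hH₀, hH₀, reassoc_of% hs])
    (by rw [hH₁, lift_fst])
    (by rw [reassoc_of% (cylEnd_zero_cylMax E)])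
    (by rw [reassoc_of% (cylEnd_zero_whiskerRight_cylMax E), Category.assoc, Category.assoc, hs,
      Category.comp_id])
    (by rw [reassoc_of% (cylEnd_one_whiskerRight_cylMax E), reassoc_of% hH₁])
  refine ⟨s, cylEnd 1 ≫ S, hs, ?_, ?_, ?_⟩
  · rw [← reassoc_of% (cylEnd_whiskerRight 1 (cylEnd 0 : E ⟶ _)), hS₀, reassoc_of% hH₁]
  · rw [← reassoc_of% (cylEnd_whiskerRight 1 (cylEnd 1 : E ⟶ _)), hS₁, lift_fst]
  · rw [Category.assoc, hSp, reassoc_of% (cylEnd_one_cylMax E), reassoc_of% hH₁]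

/-- The candidate `b ≫ s` lifts `b` but agrees with `a` only up to the fibrewise homotopy `a ▷ Δ[1]
≫ H`. Homotopy lifting over the constant homotopy at `b` corrects this. -/
theorem isTrivialFibration_of_isWeakEquivalence {E Z : SSet.{u}} (p : E ⟶ Z) [Fibration p]
    [KanComplex E] [KanComplex Z] (hp : IsWeakEquivalence p) : IsTrivialFibration p := by
  obtain ⟨s, H, hs, hH₀, hH₁, hHp⟩ := exists_section_of_isWeakEquivalence p hp
  intro A B i (hi : Mono i)
  refine ⟨fun {a b} sq ↦ ?_⟩
  obtain ⟨l, -, hl, hlp⟩ := exists_homotopy_lift 0 i p (b ≫ s) (a ▷ Δ[1] ≫ H) (fst _ _ ≫ b)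
    (by rw [reassoc_of% (cylEnd_whiskerRight 0 a), hH₀, reassoc_of% sq.w])
    (by rw [lift_fst_assoc, Category.id_comp, Category.assoc, hs, Category.comp_id])
    (by rw [Category.assoc, hHp, whiskerRight_fst_assoc, whiskerRight_fst_assoc, sq.w])
  exact ⟨⟨⟨cylEnd 1 ≫ l, by rw [← reassoc_of% (cylEnd_whiskerRight 1 i), hl,
    reassoc_of% (cylEnd_whiskerRight 1 a), hH₁, Category.comp_id],
    by rw [Category.assoc, hlp, lift_fst_assoc, Category.id_comp]⟩⟩⟩

/-- Monomorphisms which are weak equivalences have the left lifting property against Kan fibrations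
with a Kan complex as base. -/
theorem exists_lift_of_mono_of_isWeakEquivalence {A B E Z : SSet.{u}} (i : A ⟶ B) [Mono i]
    (hi : IsWeakEquivalence i) (p : E ⟶ Z) [Fibration p] [KanComplex Z] {a : A ⟶ E} {b : B ⟶ Z}
    (h : a ≫ p = i ≫ b) : ∃ l : B ⟶ E, i ≫ l = a ∧ l ≫ p = b := by
  -- Retract argument: after enlarging `B` to a Kan complex `K`, the composite `i ≫ j` is a retract
  -- of the anodyne extension `k`, since `q` is a trivial fibration.
  obtain ⟨K, j, _, hj⟩ := exists_anodyne_kanComplex B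
  obtain ⟨b', rfl⟩ := exists_extension_of_anodyne hj b
  obtain ⟨C, k, q, hk, _, hkq⟩ := exists_anodyne_fibration_factorization (i ≫ j)
  have : KanComplex C := isFibrant_of_fibration q
  have := mono_of_anodyne hj
  have hq : IsWeakEquivalence q := by
    rw [← (isWeakEquivalence_of_anodyne hk).comp_iff_right, hkq]
    exact hi.comp (isWeakEquivalence_of_anodyne hj)
  obtain ⟨s, hs, hsq⟩ := (isTrivialFibration_of_isWeakEquivalence q hq).exists_lift (i ≫ j)
    (a := k) (b := 𝟙 K) (by simpa using hkq)
  obtain ⟨e, rfl, hep⟩ := exists_lift_of_anodyne hk p (a := a) (b := q ≫ b')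
    (by rw [h, reassoc_of% hkq])
  refine ⟨j ≫ s ≫ e, ?_, ?_⟩
  · rw [← hs, Category.assoc, Category.assoc]
  · rw [Category.assoc, Category.assoc, hep, reassoc_of% hsq]

theorem exists_extension_of_mono_of_isWeakEquivalence {A B K : SSet.{u}} (i : A ⟶ B) [Mono i]
    (hi : IsWeakEquivalence i) [KanComplex K] (a : A ⟶ K) : ∃ l : B ⟶ K, i ≫ l = a := by
  have : IsIso (terminal.from (⊤_ SSet.{u})) :=
    isIso_of_isTerminal terminalIsTerminal terminalIsTerminal _
  have : KanComplex (⊤_ SSet.{u}) := by rw [KanComplex, isFibrant_iff]; infer_instance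
  obtain ⟨l, hl, -⟩ := exists_lift_of_mono_of_isWeakEquivalence i hi (terminal.from K) (a := a)
    (b := terminal.from B) (by subsingleton)
  exact ⟨l, hl⟩

end TrivialFibrations

/-! ### Base change of weak equivalences along Kan fibrations -/

section Pullbacks

open MonoidalCategory CartesianMonoidalCategory HomotopicalAlgebra SSet SSet.modelCategoryQuillen

theorem fibration_of_isPullback {P E A B : SSet.{u}} {w' : P ⟶ E} {q : P ⟶ A} {p : E ⟶ B}
    {w : A ⟶ B} (sq : IsPullback w' q p w) [Fibration p] : Fibration q := by
  have : (fibrations SSet.{u}).IsStableUnderBaseChange := by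
    rw [fibrations_eq]
    infer_instance
  rw [HomotopicalAlgebra.fibration_iff]
  exact MorphismProperty.of_isPullback (P := fibrations SSet.{u}) sq (mem_fibrations p)

/-- An anodyne extension of Kan complexes has a strong deformation retraction `D`. Lifting `D` along
`p`, constantly on `P`, deforms `E` onto `P`. -/
theorem isWeakEquivalence_of_isPullback_anodyne {P E A B : SSet.{u}} {w' : P ⟶ E} {q : P ⟶ A}
    {p : E ⟶ B} {w : A ⟶ B} (sq : IsPullback w' q p w) [Fibration p] [KanComplex A] [KanComplex B]
    (hw : anodyneExtensions w) : IsWeakEquivalence w' := by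
  obtain ⟨r, hr⟩ := exists_extension_of_anodyne hw (𝟙 A)
  obtain ⟨D, hD₀, hD₁, hD⟩ := exists_homotopy_extension_of_anodyne hw (r ≫ w) (𝟙 B)
    (fst _ _ ≫ w) (by simp [reassoc_of% hr]) (by simp)
  have := mono_of_anodyne hw
  have : Mono w' := ⟨fun a b h ↦ sq.hom_ext h (by
    rw [← cancel_mono w, Category.assoc, Category.assoc, ← sq.w, reassoc_of% h])⟩
  obtain ⟨l, hl₁, hl, hlp⟩ := exists_homotopy_lift 1 w' p (𝟙 E) (fst _ _ ≫ w') (p ▷ _ ≫ D)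
    (by simp) (by rw [reassoc_of% (cylEnd_whiskerRight 1 p), hD₁, Category.comp_id,
      Category.id_comp])
    (by rw [← comp_whiskerRight_assoc, sq.w, comp_whiskerRight_assoc, hD, Category.assoc, sq.w,
      whiskerRight_fst_assoc])
  have he : (cylEnd 0 ≫ l) ≫ p = (p ≫ r) ≫ w := by
    rw [Category.assoc, hlp, reassoc_of% (cylEnd_whiskerRight 0 p), hD₀, Category.assoc]
  have h₁ : w' ≫ sq.lift _ _ he = 𝟙 P := by
    apply sq.hom_ext
    · rw [Category.assoc, sq.lift_fst, ← reassoc_of% (cylEnd_whiskerRight 0 w'), hl,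
        lift_fst_assoc]
    · rw [Category.assoc, sq.lift_snd, reassoc_of% sq.w, hr, Category.comp_id, Category.id_comp]
  have h₂ : Homotopic (sq.lift _ _ he ≫ w') (𝟙 E) := ⟨l, (sq.lift_fst _ _ _).symm, hl₁⟩
  exact .of_homotopyInverse (h₁ ▸ .id P) (h₂.isWeakEquivalence_iff.2 (.id E))

theorem IsTrivialFibration.of_isPullback {P E A B : SSet.{u}} {w' : P ⟶ E} {q : P ⟶ A}
    {p : E ⟶ B} {w : A ⟶ B} (sq : IsPullback w' q p w) (hw : IsTrivialFibration w) :
    IsTrivialFibration w' :=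
  MorphismProperty.of_isPullback (P := (MorphismProperty.monomorphisms SSet.{u}).rlp) sq.flip hw

/-- Weak equivalences between Kan complexes are stable under base change along Kan fibrations. -/
theorem isWeakEquivalence_of_isPullback {P E A B : SSet.{u}} {w' : P ⟶ E} {q : P ⟶ A}
    {p : E ⟶ B} {w : A ⟶ B} (sq : IsPullback w' q p w) [Fibration p] [KanComplex A] [KanComplex B]
    (hw : IsWeakEquivalence w) : IsWeakEquivalence w' := by
  obtain ⟨C, j, v, hj, _, rfl⟩ := exists_anodyne_fibration_factorization w
  have : KanComplex C := isFibrant_of_fibration v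
  have hv : IsTrivialFibration v := isTrivialFibration_of_isWeakEquivalence v
    (((isWeakEquivalence_of_anodyne hj).comp_iff_right v).1 hw)
  have sq₁ := IsPullback.of_hasPullback p v
  have := fibration_of_isPullback sq₁
  have hc : w' ≫ p = (q ≫ j) ≫ v := by rw [sq.w, Category.assoc]
  have sq₂ : IsPullback (sq₁.lift _ _ hc) q (pullback.snd p v) j :=
    IsPullback.of_right (by simpa using sq) (by simp) sq₁
  have := (isWeakEquivalence_of_isPullback_anodyne sq₂ hj).comp
    (hv.of_isPullback sq₁).isWeakEquivalence
  simpa using this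

/-- A weak equivalence between Kan fibrations over `Z` induces weak equivalences on base changes. -/
theorem isWeakEquivalence_of_isPullback_over {P P' E E' C Z : SSet.{u}} [KanComplex C]
    [KanComplex Z] {c : C ⟶ Z} {e : E ⟶ Z} {e' : E' ⟶ Z} [Fibration e] [Fibration e']
    {a : P ⟶ C} {b : P ⟶ E} {a' : P' ⟶ C} {b' : P' ⟶ E'} (sq : IsPullback a b c e)
    (sq' : IsPullback a' b' c e') {w : E ⟶ E'} (hw : IsWeakEquivalence w) (hwe : w ≫ e' = e)
    {φ : P ⟶ P'} (ha : φ ≫ a' = a) (hb : φ ≫ b' = b ≫ w) : IsWeakEquivalence φ := by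
  -- Over the fibration `d`, the comparison map is a base change of `w` along a fibration. Passing
  -- from `C` to `D` changes both pullbacks only by base changes of the anodyne map `j`.
  obtain ⟨D, j, d, hj, _, rfl⟩ := exists_anodyne_fibration_factorization c
  have : KanComplex D := isFibrant_of_fibration d
  have : KanComplex E := isFibrant_of_fibration e
  have : KanComplex E' := isFibrant_of_fibration e'
  have key {P Q E : SSet.{u}} {e : E ⟶ Z} [Fibration e] {a : P ⟶ C} {b : P ⟶ E} {q₁ : Q ⟶ D}
      {q₂ : Q ⟶ E} (sq : IsPullback a b (j ≫ d) e) (sq₁ : IsPullback q₁ q₂ d e) (h) :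
      IsWeakEquivalence (sq₁.lift (a ≫ j) b h) := by
    have := fibration_of_isPullback sq₁.flip
    have sq₂ : IsPullback (sq₁.lift (a ≫ j) b h) a q₁ j :=
      IsPullback.of_right (by rw [sq₁.lift_snd]; exact sq.flip) (sq₁.lift_fst _ _ _) sq₁.flip
    exact isWeakEquivalence_of_isPullback sq₂ (isWeakEquivalence_of_anodyne hj)
  have sq₁ := IsPullback.of_hasPullback d e
  have sq₁' := IsPullback.of_hasPullback d e'
  generalize pullback d e = Q, pullback.fst d e = q₁, pullback.snd d e = q₂ at sq₁
  generalize pullback d e' = Q', pullback.fst d e' = q₁', pullback.snd d e' = q₂' at sq₁'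
  have h := key sq sq₁ (by simpa using sq.w)
  have h' := key sq' sq₁' (by simpa using sq'.w)
  have := fibration_of_isPullback sq₁'
  have hc : q₁ ≫ d = (q₂ ≫ w) ≫ e' := by rw [sq₁.w, Category.assoc, hwe]
  have sq₂ : IsPullback (sq₁'.lift _ _ hc) q₂ q₂' w :=
    IsPullback.of_right (by rwa [sq₁'.lift_fst, hwe]) (sq₁'.lift_snd _ _ _) sq₁'
  rw [← h'.comp_iff_left]
  convert h.comp (isWeakEquivalence_of_isPullback sq₂ hw) using 1
  apply sq₁'.hom_ext
  · rw [Category.assoc, sq₁'.lift_fst, reassoc_of% ha, Category.assoc (sq₁.lift _ _ _),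
      sq₁'.lift_fst, sq₁.lift_fst]
  · rw [Category.assoc, sq₁'.lift_snd, hb, Category.assoc (sq₁.lift _ _ _), sq₁'.lift_snd,
      sq₁.lift_snd_assoc]

end Pullbacks

/-! ### Independence of homotopy limits from the fibrant replacement -/

section HomotopyInvariance

open MonoidalCategory CartesianMonoidalCategory HomotopicalAlgebra SSet SSet.modelCategoryQuillen

/-- Here `D` is the mapping cylinder of `f`, and its free end is homotopic to `f ≫ r` with `r`
anodyne. -/
theorem isWeakEquivalence_of_isPushout_cylEnd {X Y D : SSet.{u}} {f : X ⟶ Y} {l : X ⊗ Δ[1] ⟶ D}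
    {r : Y ⟶ D} (sq : IsPushout (cylEnd 0) f l r) (hf : IsWeakEquivalence f) :
    IsWeakEquivalence (cylEnd 1 ≫ l) := by
  have hr : anodyneExtensions r := MorphismProperty.of_isPushout sq.flip (anodyne_cylEnd 0 X)
  have h : Homotopic (f ≫ r) (cylEnd 1 ≫ l) := ⟨l, sq.w, rfl⟩
  exact h.isWeakEquivalence_iff.1 (hf.comp (isWeakEquivalence_of_anodyne hr))

/-- The mapping cylinder is also the pushout of both ends `X ⨿ X ⟶ X ⊗ Δ[1]` along `f ⨿ 𝟙`, so `Y ⨿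
X ⟶ D` is a monomorphism. -/
theorem mono_of_isPushout_cylEnd {X Y D : SSet.{u}} {f : X ⟶ Y} {l : X ⊗ Δ[1] ⟶ D}
    {r : Y ⟶ D} (sq : IsPushout (cylEnd 0) f l r) : Mono (cylEnd 1 ≫ l) := by
  have sq₁ : IsPushout (cylEnds X) (coprod.map f (𝟙 X)) l (coprod.desc r (cylEnd 1 ≫ l)) := by
    refine IsPushout.of_left (h₁₁ := coprod.inl) (v₁₁ := f) (h₂₁ := coprod.inl) ?_ ?_
      (IsPushout.of_coprod_inl_with_id f X)
    · rwa [inl_cylEnds, coprod.inl_desc]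
    · apply coprod.hom_ext
      · rw [reassoc_of% (inl_cylEnds X), coprod.inl_map_assoc, coprod.inl_desc, sq.w]
      · rw [reassoc_of% (inr_cylEnds X), coprod.inr_map_assoc, coprod.inr_desc, Category.id_comp]
  have : Mono (coprod.desc r (cylEnd 1 ≫ l)) :=
    MorphismProperty.of_isPushout (P := MorphismProperty.monomorphisms SSet.{u}) sq₁.flip
      (mono_cylEnds X)
  rw [← coprod.inr_desc r (cylEnd 1 ≫ l)]
  infer_instance

variable {J : Type} [SmallCategory J]

/-- The inclusion of an end of the objectwise cylinder of a diagram. -/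
noncomputable def diagramCylEnd (e : Fin 2) (F : J ⥤ SSet.{u}) : F ⟶ F ⋙ tensorRight Δ[1] where
  app _ := cylEnd e
  naturality _ _ _ := rfl

/-- Maps to an injectively fibrant diagram extend, up to a natural homotopy, along objectwise
weak equivalences. -/
theorem IsInjectivelyFibrant.exists_extension {F F' G : J ⥤ SSet.{u}} (hG : IsInjectivelyFibrant G)
    (η' : F ⟶ F') (hη' : ∀ j, IsWeakEquivalence (η'.app j)) (η : F ⟶ G) :
    ∃ (θ : F' ⟶ G) (H : F ⋙ tensorRight Δ[1] ⟶ G),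
      diagramCylEnd 0 F ≫ H = η' ≫ θ ∧ diagramCylEnd 1 F ≫ H = η := by
  -- In the objectwise mapping cylinder of `η'` the free end is a monomorphism and a weak
  -- equivalence, so `η` extends along it.
  have sq := IsPushout.of_hasPushout (diagramCylEnd 0 F) η'
  generalize pushout (diagramCylEnd 0 F) η' = D, pushout.inl (diagramCylEnd 0 F) η' = l,
    pushout.inr (diagramCylEnd 0 F) η' = r at sq
  have sq' (j : J) : IsPushout (cylEnd 0) (η'.app j) (l.app j) (r.app j) :=
    sq.map ((evaluation J SSet.{u}).obj j)
  obtain ⟨ψ, hψ⟩ := hG (diagramCylEnd 1 F ≫ l) (fun j ↦ mono_of_isPushout_cylEnd (sq' j))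
    (fun j ↦ isWeakEquivalence_of_isPushout_cylEnd (sq' j) (hη' j)) η
  exact ⟨r ≫ ψ, l ≫ ψ, by rw [reassoc_of% sq.w], by rw [← hψ, Category.assoc]⟩

theorem homotopic_of_natural_homotopy {F G : J ⥤ SSet.{u}} (H : F ⋙ tensorRight Δ[1] ⟶ G)
    (c : Cone F) {t : Cone G} (ht : IsLimit t) {α β : c.pt ⟶ t.pt}
    (hα : ∀ j, α ≫ t.π.app j = c.π.app j ≫ (diagramCylEnd 0 F ≫ H).app j)
    (hβ : ∀ j, β ≫ t.π.app j = c.π.app j ≫ (diagramCylEnd 1 F ≫ H).app j) :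
    Homotopic α β := by
  let C : Cone G :=
    { pt := c.pt ⊗ Δ[1]
      π :=
        { app j := c.π.app j ▷ Δ[1] ≫ H.app j
          naturality j k f := by
            have h₁ : F.map f ▷ Δ[1] ≫ H.app k = H.app j ≫ G.map f := H.naturality f
            have h₂ := c.w f
            rw [Category.assoc, ← h₁, ← comp_whiskerRight_assoc, h₂]
            exact Category.id_comp _ } }
  have key (e : Fin 2) (j : J) :
      cylEnd e ≫ C.π.app j = c.π.app j ≫ (diagramCylEnd e F ≫ H).app j := by
    change cylEnd e ≫ c.π.app j ▷ Δ[1] ≫ H.app j = c.π.app j ≫ cylEnd e ≫ H.app j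
    rw [reassoc_of% (cylEnd_whiskerRight e (c.π.app j))]
  refine ⟨ht.lift C, ht.hom_ext fun j ↦ ?_, ht.hom_ext fun j ↦ ?_⟩
  · rw [Category.assoc, ht.fac, hα, key]
  · rw [Category.assoc, ht.fac, hβ, key]

theorem homotopic_app {F F' G : J ⥤ SSet.{u}} {η' : F ⟶ F'} {η : F ⟶ G} {θ : F' ⟶ G}
    {H : F ⋙ tensorRight Δ[1] ⟶ G} (h₀ : diagramCylEnd 0 F ≫ H = η' ≫ θ)
    (h₁ : diagramCylEnd 1 F ≫ H = η) (j : J) : Homotopic (η'.app j ≫ θ.app j) (η.app j) :=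
  ⟨H.app j, by rw [← NatTrans.comp_app, ← h₀]; rfl, by rw [← h₁]; rfl⟩

theorem IsInjectivelyFibrant.exists_homotopyRetraction {G G' : J ⥤ SSet.{u}}
    (hG : IsInjectivelyFibrant G) (θ : G ⟶ G') (hθ : ∀ j, IsWeakEquivalence (θ.app j)) :
    ∃ θ' : G' ⟶ G, (∀ j, IsWeakEquivalence (θ'.app j)) ∧
      ∀ (t : Cone G) (_ : IsLimit t) (α : t.pt ⟶ t.pt),
        (∀ j, α ≫ t.π.app j = t.π.app j ≫ θ.app j ≫ θ'.app j) → IsWeakEquivalence α := by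
  obtain ⟨θ', H, h₀, h₁⟩ := hG.exists_extension θ hθ (𝟙 G)
  refine ⟨θ', fun j ↦ ?_, fun t ht α hα ↦ ?_⟩
  · exact ((hθ j).comp_iff_right _).1 ((homotopic_app h₀ h₁ j).isWeakEquivalence_iff.2 (.id _))
  · have h : Homotopic α (𝟙 t.pt) := homotopic_of_natural_homotopy H t ht
      (fun j ↦ by rw [hα, h₀, NatTrans.comp_app])
      (fun j ↦ by rw [h₁, NatTrans.id_app, Category.id_comp, Category.comp_id])
    exact h.isWeakEquivalence_iff.2 (.id _)

/-- Objectwise weak equivalences between injectively fibrant diagrams induce weak equivalences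
on limits. -/
theorem IsInjectivelyFibrant.isWeakEquivalence_of_isLimit {G G' : J ⥤ SSet.{u}}
    (hG : IsInjectivelyFibrant G) (hG' : IsInjectivelyFibrant G') (θ : G ⟶ G')
    (hθ : ∀ j, IsWeakEquivalence (θ.app j)) {t : Cone G} (ht : IsLimit t) {t' : Cone G'}
    (ht' : IsLimit t') : IsWeakEquivalence (ht'.lift ((Cone.postcompose θ).obj t)) := by
  -- Two-out-of-six on limits: `θ'` is a homotopy retraction of `θ`, and `θ''` one of `θ'`.
  obtain ⟨θ', hθ', h⟩ := hG.exists_homotopyRetraction θ hθ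
  obtain ⟨θ'', -, h'⟩ := hG'.exists_homotopyRetraction θ' hθ'
  have fac {G G' : J ⥤ SSet.{u}} (θ : G ⟶ G') (t : Cone G) {t' : Cone G'} (ht' : IsLimit t')
      (j : J) : ht'.lift ((Cone.postcompose θ).obj t) ≫ t'.π.app j = t.π.app j ≫ θ.app j :=
    ht'.fac _ _
  refine .of_comp_of_comp (h t ht (_ ≫ ht.lift ((Cone.postcompose θ').obj t')) fun j ↦ ?_)
    (h' t' ht' (_ ≫ ht'.lift ((Cone.postcompose θ'').obj t)) fun j ↦ ?_)
  · rw [Category.assoc, fac, reassoc_of% (fac θ t ht' j)]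
  · rw [Category.assoc, fac, reassoc_of% (fac θ' t' ht j)]

/-- Homotopy limit cones can be detected on any injectively fibrant replacement. -/
theorem isHomotopyLimit_iff {F G : J ⥤ SSet.{u}} (η : F ⟶ G)
    (hη : ∀ j, IsWeakEquivalence (η.app j)) (hG : IsInjectivelyFibrant G) {t : Cone G}
    (ht : IsLimit t) (c : Cone F) {φ : c.pt ⟶ t.pt}
    (hφ : ∀ j, φ ≫ t.π.app j = c.π.app j ≫ η.app j) :
    IsHomotopyLimit c ↔ IsWeakEquivalence φ := by
  obtain rfl : ht.lift ((Cone.postcompose η).obj c) = φ :=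
    ht.hom_ext fun j ↦ (ht.fac _ _).trans (hφ j).symm
  refine ⟨?_, fun h ↦ ⟨G, η, t, ht, hG, hη, h⟩⟩
  rintro ⟨F', η', t', ht', hF', hη', h⟩
  -- The two replacements are compared by a map that is compatible with `η'` and `η` only up to
  -- natural homotopy, which suffices after taking limits.
  obtain ⟨θ, H, h₀, h₁⟩ := hG.exists_extension η' hη' η
  have hθ (j : J) : IsWeakEquivalence (θ.app j) :=
    ((hη' j).comp_iff_right _).1 ((homotopic_app h₀ h₁ j).isWeakEquivalence_iff.2 (hη j))
  have h₂ : Homotopic (ht'.lift ((Cone.postcompose η').obj c) ≫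
      ht.lift ((Cone.postcompose θ).obj t')) (ht.lift ((Cone.postcompose η).obj c)) := by
    refine homotopic_of_natural_homotopy H c ht (fun j ↦ ?_) (fun j ↦ ?_)
    · rw [Category.assoc, ht.fac, h₀, NatTrans.comp_app]
      have h₃ : ht'.lift ((Cone.postcompose η').obj c) ≫ t'.π.app j = c.π.app j ≫ η'.app j :=
        ht'.fac _ _
      have h₄ := reassoc_of% h₃
      exact h₄ (θ.app j)
    · rw [h₁, hφ]
  exact h₂.isWeakEquivalence_iff.1
    (h.comp (hF'.isWeakEquivalence_of_isLimit hG θ hθ ht' ht))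

end HomotopyInvariance

/-! ### Homotopy cartesian squares -/

section HomotopyCartesian

open HomotopicalAlgebra SSet SSet.modelCategoryQuillen

/-- Extend at the corner first, where `Z` is Kan, then lift along each leg. -/
theorem isInjectivelyFibrant_cospan {X Y Z : SSet.{u}} (r : X ⟶ Z) (b : Y ⟶ Z) [Fibration r]
    [Fibration b] [KanComplex Z] : IsInjectivelyFibrant (cospan r b) := by
  intro A B i _ hi g
  obtain ⟨h₁, hh₁⟩ := exists_extension_of_mono_of_isWeakEquivalence (i.app .one) (hi _)
    (K := Z) (g.app .one)
  have key (j : WalkingPair) {E : SSet.{u}} (p : E ⟶ Z) [Fibration p] (a : A.obj (some j) ⟶ E)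
      (ha : a ≫ p = A.map (WidePullbackShape.Hom.term j) ≫ g.app .one) :
      ∃ l : B.obj (some j) ⟶ E, i.app (some j) ≫ l = a ∧
        l ≫ p = B.map (WidePullbackShape.Hom.term j) ≫ h₁ :=
    exists_lift_of_mono_of_isWeakEquivalence (i.app (some j)) (hi _) p (by
      rw [ha, ← NatTrans.naturality_assoc, ← hh₁]
      rfl)
  obtain ⟨hl, hhl, hlr⟩ := key .left r (g.app .left) (g.naturality WalkingCospan.Hom.inl).symm
  obtain ⟨hr, hhr, hrb⟩ := key .right b (g.app .right) (g.naturality WalkingCospan.Hom.inr).symm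
  refine ⟨cospanHomMk h₁ hl hr hlr.symm hrb.symm, ?_⟩
  ext1
  funext j
  obtain _ | _ | _ := j
  exacts [hh₁, hhl, hhr]

/-- A square can be tested for being homotopy cartesian after replacing the lower right corner by
a Kan complex and one of the two maps to it by a Kan fibration. -/
theorem isHomotopyCartesian_iff {W X Y Z X' Y' Z' P : SSet.{u}} {t : W ⟶ X} {l : W ⟶ Y}
    {r : X ⟶ Z} {b : Y ⟶ Z} (sq : CommSq t l r b) {x : X ⟶ X'} {y : Y ⟶ Y'} {z : Z ⟶ Z'}
    (hx : IsWeakEquivalence x) (hy : IsWeakEquivalence y) (hz : IsWeakEquivalence z)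
    [KanComplex X'] [KanComplex Z'] {r' : X' ⟶ Z'} {b' : Y' ⟶ Z'} [Fibration b']
    (hr : r ≫ z = x ≫ r') (hb : b ≫ z = y ≫ b') {p₁ : P ⟶ X'} {p₂ : P ⟶ Y'}
    (sq' : IsPullback p₁ p₂ r' b') {φ : W ⟶ P} (h₁ : φ ≫ p₁ = t ≫ x) (h₂ : φ ≫ p₂ = l ≫ y) :
    IsHomotopyCartesian sq ↔ IsWeakEquivalence φ := by
  -- Making the other leg a fibration as well changes the pullback only by a base change of the
  -- anodyne map `k`.
  obtain ⟨X'', k, q, hk, _, rfl⟩ := exists_anodyne_fibration_factorization r'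
  have : KanComplex X'' := isFibrant_of_fibration q
  have hk' := isWeakEquivalence_of_anodyne hk
  have sqQ := IsPullback.of_hasPullback q b'
  generalize pullback q b' = Q, pullback.fst q b' = q₁, pullback.snd q b' = q₂ at sqQ
  have hc : (p₁ ≫ k) ≫ q = p₂ ≫ b' := by rw [Category.assoc, sq'.w]
  have sqP : IsPullback (sqQ.lift _ _ hc) p₁ q₁ k :=
    IsPullback.of_right (by rw [sqQ.lift_snd]; exact sq'.flip) (sqQ.lift_fst _ _ _) sqQ.flip
  have := fibration_of_isPullback sqQ.flip
  have hν := isWeakEquivalence_of_isPullback sqP hk'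
  let η : cospan r b ⟶ cospan q b' :=
    cospanHomMk z (x ≫ k) y (hr.trans (Category.assoc _ _ _).symm) hb
  have hη (j) : IsWeakEquivalence (η.app j) := by
    obtain _ | _ | _ := j
    exacts [hz, hx.comp hk', hy]
  have hφl : (φ ≫ sqQ.lift _ _ hc) ≫ q₁ = t ≫ x ≫ k := by
    rw [Category.assoc, sqQ.lift_fst, reassoc_of% h₁]
  have hφr : (φ ≫ sqQ.lift _ _ hc) ≫ q₂ = l ≫ y := by
    rw [Category.assoc, sqQ.lift_snd, h₂]
  have hφz : (φ ≫ sqQ.lift _ _ hc) ≫ q₁ ≫ q = (t ≫ r) ≫ z := by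
    rw [← Category.assoc, hφl, Category.assoc, Category.assoc, Category.assoc, hr]
  rw [← hν.comp_iff_left]
  refine isHomotopyLimit_iff η hη (isInjectivelyFibrant_cospan q b') sqQ.isLimit
    (PullbackCone.mk t l sq.w) fun j ↦ ?_
  obtain _ | _ | _ := j
  · exact hφz
  · exact hφl
  · exact hφr

/-- The pasting law for homotopy cartesian squares. -/
theorem isHomotopyCartesian_paste_iff {W V X Y U Z : SSet.{u}} {t₁ : W ⟶ V} {t₂ : V ⟶ X}
    {t : W ⟶ X} {l : W ⟶ Y} {m : V ⟶ U} {r : X ⟶ Z} {b₁ : Y ⟶ U} {b₂ : U ⟶ Z} {b : Y ⟶ Z}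
    (sq₁ : CommSq t₁ l m b₁) (sq₂ : CommSq t₂ m r b₂) (sq : CommSq t l r b)
    (ht : t₁ ≫ t₂ = t) (hb : b₁ ≫ b₂ = b) (h₂ : IsHomotopyCartesian sq₂) :
    IsHomotopyCartesian sq ↔ IsHomotopyCartesian sq₁ := by
  subst ht hb
  obtain ⟨Z', z, _, hz⟩ := exists_anodyne_kanComplex Z
  obtain ⟨U', v, d, hv, _, hvd⟩ := exists_anodyne_fibration_factorization (b₂ ≫ z)
  obtain ⟨Y', y, e, hy, _, hye⟩ := exists_anodyne_fibration_factorization (b₁ ≫ v)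
  obtain ⟨X', x, q, hx, _, hxq⟩ := exists_anodyne_fibration_factorization (r ≫ z)
  have : KanComplex X' := isFibrant_of_fibration q
  have : KanComplex U' := isFibrant_of_fibration d
  have hx := isWeakEquivalence_of_anodyne hx
  have hy := isWeakEquivalence_of_anodyne hy
  have hv := isWeakEquivalence_of_anodyne hv
  have hz := isWeakEquivalence_of_anodyne hz
  have sqV := IsPullback.of_hasPullback q d
  generalize pullback q d = V', pullback.fst q d = v₁, pullback.snd q d = v₂ at sqV
  have := fibration_of_isPullback sqV
  have : KanComplex V' := isFibrant_of_fibration v₂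
  have sqW := IsPullback.of_hasPullback v₂ e
  generalize pullback v₂ e = W', pullback.fst v₂ e = w₁, pullback.snd v₂ e = w₂ at sqW
  have hc : (t₂ ≫ x) ≫ q = (m ≫ v) ≫ d := by
    rw [Category.assoc, hxq, Category.assoc, hvd, reassoc_of% sq₂.w]
  -- As the second square is homotopy cartesian, `V'` is a valid replacement of `V`, and the pasting
  -- law becomes that of strict pullbacks.
  rw [isHomotopyCartesian_iff sq₂ hx hv hz hxq.symm hvd.symm sqV (sqV.lift_fst _ _ hc)
    (sqV.lift_snd _ _ hc)] at h₂
  have hc' : (t₁ ≫ sqV.lift _ _ hc) ≫ v₂ = (l ≫ y) ≫ e := by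
    rw [Category.assoc, sqV.lift_snd, Category.assoc, hye, reassoc_of% sq₁.w]
  rw [isHomotopyCartesian_iff sq₁ h₂ hy hv (sqV.lift_snd _ _ hc).symm hye.symm sqW
    (sqW.lift_fst _ _ hc') (sqW.lift_snd _ _ hc')]
  refine isHomotopyCartesian_iff sq hx hy hz hxq.symm (b' := e ≫ d) ?_ (sqW.paste_horiz sqV) ?_
    (sqW.lift_snd _ _ hc')
  · rw [reassoc_of% hye, hvd, Category.assoc]
  · rw [sqW.lift_fst_assoc, Category.assoc, sqV.lift_fst, Category.assoc]

end HomotopyCartesian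

/-! ### Limits of zigzags as iterated pullbacks -/

section Chains

open HomotopicalAlgebra SSet SSet.modelCategoryQuillen

variable {E Z : SSet.{u}}

/-- The zigzag `E ⟶ Z ⟵ E ⟶ ⋯ ⟵ E` on `k + 1` copies of `E`, in which the arrows to the right are
`t` and the arrows to the left are `s`. -/
abbrev chainIndex (s t : E ⟶ Z) (k : ℕ) : MulticospanIndex (zigzagShape k) SSet.{u} where
  left _ := E
  right _ := Z
  fst _ := t
  snd _ := s

/-- A limit of the zigzag `E ⟶ Z ⟵ E ⟶ ⋯ ⟵ E`. -/
structure ChainLimit (s t : E ⟶ Z) (k : ℕ) where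
  /-- the limit object -/
  pt : SSet.{u}
  /-- the projections -/
  π : Fin (k + 1) → (pt ⟶ E)
  w : ∀ b : Fin k, π b.castSucc ≫ t = π b.succ ≫ s
  /-- the universal property -/
  isLimit : IsLimit (Multifork.ofι (chainIndex s t k) pt π w)

namespace ChainLimit

variable {s t : E ⟶ Z} {k : ℕ}

theorem nonempty (s t : E ⟶ Z) (k : ℕ) : Nonempty (ChainLimit s t k) := by
  let K : Multifork (chainIndex s t k) := limit.cone (chainIndex s t k).multicospan
  have hK : IsLimit K := limit.isLimit _
  exact ⟨{ pt := K.pt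
           π := K.ι
           w := K.condition
           isLimit := IsLimit.ofIsoLimit hK K.isoOfι }⟩

theorem hom_ext (K : ChainLimit s t k) {T : SSet.{u}} {f g : T ⟶ K.pt}
    (h : ∀ a, f ≫ K.π a = g ≫ K.π a) : f = g :=
  Multifork.IsLimit.hom_ext K.isLimit h

theorem exists_lift (K : ChainLimit s t k) {T : SSet.{u}} (p : Fin (k + 1) → (T ⟶ E))
    (hp : ∀ b : Fin k, p b.castSucc ≫ t = p b.succ ≫ s) :
    ∃ f : T ⟶ K.pt, ∀ a, f ≫ K.π a = p a :=
  ⟨Multifork.IsLimit.lift K.isLimit p hp, Multifork.IsLimit.fac K.isLimit p hp⟩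

theorem isIso_π_zero (K : ChainLimit s t 0) : IsIso (K.π 0) := by
  obtain ⟨f, hf⟩ := K.exists_lift (fun _ ↦ 𝟙 E) (fun b ↦ b.elim0)
  refine ⟨f, K.hom_ext fun a ↦ ?_, hf 0⟩
  obtain rfl : a = 0 := Fin.fin_one_eq_zero a
  rw [Category.assoc, hf, Category.comp_id, Category.id_comp]

/-- The limit of the zigzag with one more source is a pullback. -/
theorem isPullback (K' : ChainLimit s t (k + 1)) (K : ChainLimit s t k) {r : K'.pt ⟶ K.pt}
    (hr : ∀ a, r ≫ K.π a = K'.π a.castSucc) :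
    IsPullback r (K'.π (Fin.last _)) (K.π (Fin.last _) ≫ t) s := by
  have w : r ≫ K.π (Fin.last _) ≫ t = K'.π (Fin.last _) ≫ s := by
    rw [reassoc_of% hr, K'.w (Fin.last k), Fin.succ_last]
  have key (c : PullbackCone (K.π (Fin.last _) ≫ t) s) :
      ∃ f : c.pt ⟶ K'.pt, f ≫ r = c.fst ∧ f ≫ K'.π (Fin.last _) = c.snd := by
    obtain ⟨f, hf⟩ := K'.exists_lift
      (Fin.lastCases (motive := fun _ ↦ c.pt ⟶ E) c.snd (fun a ↦ c.fst ≫ K.π a)) (by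
        intro b
        induction b using Fin.lastCases with
        | last =>
          rw [Fin.succ_last, Fin.lastCases_last, Fin.lastCases_castSucc, Category.assoc,
            c.condition]
        | cast b =>
          rw [← Fin.castSucc_succ, Fin.lastCases_castSucc, Fin.lastCases_castSucc, Category.assoc,
            Category.assoc, K.w])
    refine ⟨f, K.hom_ext fun a ↦ ?_, ?_⟩
    · rw [Category.assoc, hr, hf, Fin.lastCases_castSucc]
    · rw [hf, Fin.lastCases_last]
  choose f hf₁ hf₂ using key
  refine ⟨⟨w⟩, ⟨PullbackCone.IsLimit.mk w f hf₁ hf₂ fun c m h₁ h₂ ↦ K'.hom_ext fun a ↦ ?_⟩⟩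
  induction a using Fin.lastCases with
  | last => rw [h₂, hf₂]
  | cast a => rw [← hr, reassoc_of% h₁, reassoc_of% hf₁]

/-- Forgetting the last copy of `E` is a base change of `s`. -/
theorem fibration_source [Fibration s] (K : ChainLimit s t k) : Fibration (K.π 0 ≫ s) := by
  induction k with
  | zero =>
    have := K.isIso_π_zero
    infer_instance
  | succ k ih =>
    obtain ⟨K₀⟩ := ChainLimit.nonempty s t k
    obtain ⟨r, hr⟩ := K₀.exists_lift (fun a ↦ K.π a.castSucc) (fun b ↦ K.w b.castSucc)
    have := fibration_of_isPullback (K.isPullback K₀ hr).flip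
    have := ih K₀
    have h : K.π 0 ≫ s = r ≫ K₀.π 0 ≫ s := by rw [reassoc_of% hr, Fin.castSucc_zero]
    rw [h]
    infer_instance

/-- If `E` is the homotopy pullback of `E'` along `Z ⟶ Z'` via `s`, the same holds for the
limits of zigzags. -/
theorem isWeakEquivalence_of_isPullback [KanComplex Z] [Fibration s] {E' Z' : SSet.{u}}
    [KanComplex Z'] {s' t' : E' ⟶ Z'} [Fibration s'] {z : Z ⟶ Z'} {e : E ⟶ E'}
    (ht : e ≫ t' = t ≫ z)
    (H : ∀ ⦃Q : SSet.{u}⦄ ⦃q₁ : Q ⟶ Z⦄ ⦃q₂ : Q ⟶ E'⦄, IsPullback q₁ q₂ z s' →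
      ∃ ψ : E ⟶ Q, ψ ≫ q₁ = s ∧ ψ ≫ q₂ = e ∧ IsWeakEquivalence ψ)
    (K : ChainLimit s t k) (L : ChainLimit s' t' k) {P : SSet.{u}} {p₁ : P ⟶ Z} {p₂ : P ⟶ L.pt}
    (sq : IsPullback p₁ p₂ z (L.π 0 ≫ s')) {φ : K.pt ⟶ P} (hφ₁ : φ ≫ p₁ = K.π 0 ≫ s)
    (hφ₂ : ∀ a, φ ≫ p₂ ≫ L.π a = K.π a ≫ e) : IsWeakEquivalence φ := by
  induction k generalizing P with
  | zero =>
    have := K.isIso_π_zero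
    have := L.isIso_π_zero
    have sq' : IsPullback p₁ (p₂ ≫ L.π 0) z s' := by
      simpa using sq.paste_vert (IsPullback.of_vert_isIso (fst := L.π 0 ≫ s') (snd := L.π 0)
        (f := 𝟙 Z') (g := s') ⟨by simp⟩)
    obtain ⟨ψ, h₁, h₂, hψ⟩ := H sq'
    convert (IsWeakEquivalence.of_isIso (K.π 0)).comp hψ using 1
    apply sq'.hom_ext
    · rw [hφ₁, Category.assoc, h₁]
    · rw [hφ₂, Category.assoc, h₂]
  | succ k ih =>
    -- With `P₀ = Z ×_{Z'} L₀` and `Q = Z ×_{Z'} E'`, one has `P = P₀ ×_{Z'} E'`, and `M = K₀ ×_{P₀}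
    -- P` is also `K₀ ×_Z Q`. The map `φ` factors as `χ : K ⟶ M`, induced by `ψ : E ⟶ Q` over `Z`,
    -- followed by `m₂ : M ⟶ P`, a base change of `φ₀`.
    obtain ⟨K₀⟩ := ChainLimit.nonempty s t k
    obtain ⟨L₀⟩ := ChainLimit.nonempty s' t' k
    obtain ⟨r, hr⟩ := K₀.exists_lift (fun a ↦ K.π a.castSucc) (fun b ↦ K.w b.castSucc)
    obtain ⟨r', hr'⟩ := L₀.exists_lift (fun a ↦ L.π a.castSucc) (fun b ↦ L.w b.castSucc)
    have hr₀ : K.π 0 ≫ s = r ≫ K₀.π 0 ≫ s := by rw [reassoc_of% hr, Fin.castSucc_zero]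
    have hr₀' : L.π 0 ≫ s' = r' ≫ L₀.π 0 ≫ s' := by rw [reassoc_of% hr', Fin.castSucc_zero]
    have := K₀.fibration_source
    have := L₀.fibration_source
    have : KanComplex K₀.pt := isFibrant_of_fibration (K₀.π 0 ≫ s)
    obtain ⟨P₀, a₁, a₂, sq₀⟩ : ∃ (P₀ : SSet.{u}) (a₁ : P₀ ⟶ Z) (a₂ : P₀ ⟶ L₀.pt),
      IsPullback a₁ a₂ z (L₀.π 0 ≫ s') := ⟨_, _, _, .of_hasPullback _ _⟩
    have := fibration_of_isPullback sq₀.flip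
    have : KanComplex P₀ := isFibrant_of_fibration a₁
    obtain ⟨Q, q₁, q₂, sqQ⟩ : ∃ (Q : SSet.{u}) (q₁ : Q ⟶ Z) (q₂ : Q ⟶ E'),
      IsPullback q₁ q₂ z s' := ⟨_, _, _, .of_hasPullback _ _⟩
    obtain ⟨ψ, hψ₁, hψ₂, hψ⟩ := H sqQ
    have := fibration_of_isPullback sqQ.flip
    have hs : e ≫ s' = s ≫ z := by
      rw [← hψ₁, ← hψ₂, Category.assoc, Category.assoc, sqQ.w]
    obtain ⟨c, hc⟩ := L₀.exists_lift (fun a ↦ K₀.π a ≫ e) (fun b ↦ by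
      rw [Category.assoc, Category.assoc, ht, hs, reassoc_of% K₀.w b])
    obtain ⟨φ₀, hφ₀₁, hφ₀₂⟩ : ∃ φ₀ : K₀.pt ⟶ P₀, φ₀ ≫ a₁ = K₀.π 0 ≫ s ∧ φ₀ ≫ a₂ = c := by
      refine ⟨sq₀.lift (K₀.π 0 ≫ s) c ?_, sq₀.lift_fst _ _ _, sq₀.lift_snd _ _ _⟩
      rw [reassoc_of% hc, hs, Category.assoc]
    have hφ₀ : IsWeakEquivalence φ₀ :=
      ih K₀ L₀ sq₀ hφ₀₁ (fun a ↦ by rw [reassoc_of% hφ₀₂, hc])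
    rw [hr₀'] at sq
    rw [hr₀] at hφ₁
    obtain ⟨ρ, hρ₁, hρ₂⟩ : ∃ ρ : P ⟶ P₀, ρ ≫ a₁ = p₁ ∧ ρ ≫ a₂ = p₂ ≫ r' := by
      refine ⟨sq₀.lift p₁ (p₂ ≫ r') ?_, sq₀.lift_fst _ _ _, sq₀.lift_snd _ _ _⟩
      rw [sq.w, Category.assoc]
    have sq₁ : IsPullback ρ p₂ a₂ r' := .of_right (by rwa [hρ₁]) hρ₂ sq₀
    have sq₂ := sq₁.paste_vert (L.isPullback L₀ hr')
    have := fibration_of_isPullback sq₂.flip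
    obtain ⟨M, m₁, m₂, sqM⟩ : ∃ (M : SSet.{u}) (m₁ : M ⟶ K₀.pt) (m₂ : M ⟶ P),
      IsPullback m₁ m₂ φ₀ ρ := ⟨_, _, _, .of_hasPullback _ _⟩
    have hm₂ : IsWeakEquivalence m₂ :=
      SimplicialSpace.isWeakEquivalence_of_isPullback sqM.flip hφ₀
    have hlast : φ₀ ≫ a₂ ≫ L₀.π (Fin.last _) ≫ t' = (K₀.π (Fin.last _) ≫ t) ≫ z := by
      rw [reassoc_of% hφ₀₂, reassoc_of% hc, ht, Category.assoc]
    have sq₃ := sqM.paste_vert sq₂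
    rw [hlast] at sq₃
    obtain ⟨μ, hμ₁, hμ₂⟩ : ∃ μ : M ⟶ Q, μ ≫ q₁ = m₁ ≫ K₀.π (Fin.last _) ≫ t ∧
        μ ≫ q₂ = m₂ ≫ p₂ ≫ L.π (Fin.last _) := by
      refine ⟨sqQ.lift _ _ ?_, sqQ.lift_fst _ _ _, sqQ.lift_snd _ _ _⟩
      rw [Category.assoc, ← sq₃.w]
    rw [← hμ₂] at sq₃
    have sq₄ : IsPullback m₁ μ (K₀.π (Fin.last _) ≫ t) q₁ := sq₃.of_bot hμ₁.symm sqQ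
    have hχ : r ≫ φ₀ = φ ≫ ρ := by
      apply sq₀.hom_ext
      · rw [Category.assoc, Category.assoc, hφ₀₁, hρ₁, hφ₁]
      · apply L₀.hom_ext
        intro a
        rw [Category.assoc, Category.assoc, Category.assoc, Category.assoc, reassoc_of% hφ₀₂,
          reassoc_of% hρ₂, hc, hr', hφ₂, reassoc_of% hr]
    obtain ⟨χ, hχ₁, hχ₂⟩ : ∃ χ : K.pt ⟶ M, χ ≫ m₁ = r ∧ χ ≫ m₂ = φ :=
      ⟨sqM.lift r φ hχ, sqM.lift_fst _ _ _, sqM.lift_snd _ _ _⟩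
    rw [← hχ₂]
    refine IsWeakEquivalence.comp ?_ hm₂
    refine isWeakEquivalence_of_isPullback_over (K.isPullback K₀ hr) sq₄ hψ hψ₁ hχ₁ ?_
    apply sqQ.hom_ext
    · rw [Category.assoc, hμ₁, reassoc_of% hχ₁, Category.assoc, hψ₁, reassoc_of% hr,
        K.w (Fin.last k), Fin.succ_last]
    · rw [Category.assoc, hμ₂, reassoc_of% hχ₂, hφ₂, Category.assoc, hψ₂]

end ChainLimit

end Chains

/-! ### Fibrant models of Segal diagrams and the first vertex criterion -/

section SegalSpaces

open HomotopicalAlgebra SSet SSet.modelCategoryQuillen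

instance : (fibrations SSet.{u}).IsStableUnderBaseChange := by
  rw [fibrations_eq]
  infer_instance

theorem kanComplex_prod (X Y : SSet.{u}) [KanComplex X] [KanComplex Y] : KanComplex (X ⨯ Y) :=
  isFibrant_of_fibration (prod.snd : X ⨯ Y ⟶ Y)

/-- Extend at the copies of `Z` first. Each copy of `E` then poses a lifting problem against `(s,
t)`, which is why this pair has to be a fibration jointly. -/
theorem isInjectivelyFibrant_chain {E Z : SSet.{u}} (s t : E ⟶ Z) [KanComplex Z]
    [Fibration (prod.lift s t)] (k : ℕ) :
    IsInjectivelyFibrant (chainIndex s t k).multicospan := by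
  intro A B i _ hi g
  have := kanComplex_prod Z Z
  let mt (b : Fin k) : WalkingMulticospan.left (J := zigzagShape k) b.castSucc ⟶ .right b :=
    WalkingMulticospan.Hom.fst (J := zigzagShape k) b
  let ms (b : Fin k) : WalkingMulticospan.left (J := zigzagShape k) b.succ ⟶ .right b :=
    WalkingMulticospan.Hom.snd (J := zigzagShape k) b
  let gL (a : Fin (k + 1)) : A.obj (.left a) ⟶ E := g.app (.left a)
  let gR (b : Fin k) : A.obj (.right b) ⟶ Z := g.app (.right b)
  have hgt (b : Fin k) : A.map (mt b) ≫ gR b = gL b.castSucc ≫ t := g.naturality (mt b)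
  have hgs (b : Fin k) : A.map (ms b) ≫ gR b = gL b.succ ≫ s := g.naturality (ms b)
  have ext (j) (f : A.obj j ⟶ Z) : ∃ h : B.obj j ⟶ Z, i.app j ≫ h = f :=
    exists_extension_of_mono_of_isWeakEquivalence (i.app j) (hi j) f
  choose ext hext using ext
  let hR (b : Fin k) : B.obj (.right b) ⟶ Z := ext (.right b) (gR b)
  have hhR (b : Fin k) : i.app (.right b) ≫ hR b = gR b := hext _ _
  -- The maps `u` and `v` are the prescribed sources and targets. The source of the first copy and
  -- the target of the last are not constrained by the zigzag, so they are extended freely.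
  obtain ⟨u, hu, hus⟩ : ∃ u : ∀ a : Fin (k + 1), B.obj (.left a) ⟶ Z,
      (∀ a, i.app (.left a) ≫ u a = gL a ≫ s) ∧
      ∀ b : Fin k, u b.succ = B.map (ms b) ≫ hR b := by
    refine ⟨Fin.cases (ext (.left 0) (gL 0 ≫ s))
      (fun b ↦ B.map (ms b) ≫ hR b), fun a ↦ ?_, fun b ↦ rfl⟩
    induction a using Fin.cases with
    | zero => exact hext _ _
    | succ b =>
      rw [← hgs, ← hhR, i.naturality_assoc]
      rfl
  obtain ⟨v, hv, hvt⟩ : ∃ v : ∀ a : Fin (k + 1), B.obj (.left a) ⟶ Z,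
      (∀ a, i.app (.left a) ≫ v a = gL a ≫ t) ∧
      ∀ b : Fin k, v b.castSucc = B.map (mt b) ≫ hR b := by
    refine ⟨Fin.lastCases (ext (.left (Fin.last k)) (gL _ ≫ t))
      (fun b ↦ B.map (mt b) ≫ hR b), fun a ↦ ?_,
      fun b ↦ Fin.lastCases_castSucc _⟩
    induction a using Fin.lastCases with
    | last =>
      beta_reduce
      rw [Fin.lastCases_last]
      exact hext _ _
    | cast b =>
      beta_reduce
      rw [Fin.lastCases_castSucc, ← hgt, ← hhR, i.naturality_assoc]
  have key (a : Fin (k + 1)) : ∃ l : B.obj (.left a) ⟶ E, i.app (.left a) ≫ l = gL a ∧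
      l ≫ prod.lift s t = prod.lift (u a) (v a) :=
    exists_lift_of_mono_of_isWeakEquivalence (i.app (.left a)) (hi _) (prod.lift s t) (by
      rw [prod.comp_lift, prod.comp_lift, hu, hv])
  choose hL hhL hst using key
  have hs (a) : hL a ≫ s = u a := by
    rw [← prod.lift_fst s t, reassoc_of% hst a, prod.lift_fst]
  have ht (a) : hL a ≫ t = v a := by
    rw [← prod.lift_snd s t, reassoc_of% hst a, prod.lift_snd]
  refine ⟨{ app := fun j ↦ match j with
              | .left a => hL a
              | .right b => hR b
            naturality := ?_ }, ?_⟩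
  · rintro _ _ (_ | b | b)
    · rw [WalkingMulticospan.Hom.id_eq_id, CategoryTheory.Functor.map_id,
        CategoryTheory.Functor.map_id, Category.id_comp, Category.comp_id]
    · exact (hvt b).symm.trans (ht _).symm
    · exact (hus b).symm.trans (hs _).symm
  · ext1
    funext j
    obtain a | b := j
    exacts [hhL a, hhR b]

/-- A replacement of the source and target maps `X₁ ⟶ X₀` of a simplicial space by maps
`s, t : E ⟶ Z` such that `Z` is a Kan complex and `(s, t)` is a Kan fibration. -/
structure SourceTargetModel (X : SimplicialObject SSet.{u}) where
  /-- the replacement of `X₁` -/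
  E : SSet.{u}
  /-- the replacement of `X₀` -/
  Z : SSet.{u}
  /-- the replacement of the source map -/
  s : E ⟶ Z
  /-- the replacement of the target map -/
  t : E ⟶ Z
  /-- the comparison map on `X₁` -/
  e : X _⦋1⦌ ⟶ E
  /-- the comparison map on `X₀` -/
  z : X _⦋0⦌ ⟶ Z
  anodyne_e : anodyneExtensions e
  anodyne_z : anodyneExtensions z
  w_s : X.δ 1 ≫ z = e ≫ s
  w_t : X.δ 0 ≫ z = e ≫ t
  kanComplex : KanComplex Z
  fibration : Fibration (prod.lift s t)

namespace SourceTargetModel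

attribute [instance] kanComplex fibration

theorem nonempty (X : SimplicialObject SSet.{u}) : Nonempty (SourceTargetModel X) := by
  obtain ⟨Z, z, _, hz⟩ := exists_anodyne_kanComplex (X _⦋0⦌)
  obtain ⟨E, e, p, he, _, hp⟩ :=
    exists_anodyne_fibration_factorization (prod.lift (X.δ 1 ≫ z) (X.δ 0 ≫ z))
  exact ⟨{ E := E, Z := Z, s := p ≫ prod.fst, t := p ≫ prod.snd, e := e, z := z
           anodyne_e := he
           anodyne_z := hz
           w_s := by rw [reassoc_of% hp, prod.lift_fst]
           w_t := by rw [reassoc_of% hp, prod.lift_snd]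
           kanComplex := ‹_›
           fibration := by rwa [← prod.comp_lift, prod.lift_fst_snd, Category.comp_id] }⟩

variable {X B : SimplicialObject SSet.{u}} (M : SourceTargetModel X) (N : SourceTargetModel B)

theorem isWeakEquivalence_e : IsWeakEquivalence M.e :=
  isWeakEquivalence_of_anodyne M.anodyne_e

theorem isWeakEquivalence_z : IsWeakEquivalence M.z :=
  isWeakEquivalence_of_anodyne M.anodyne_z

instance fibration_s : Fibration M.s := by
  rw [← prod.lift_fst M.s M.t]
  infer_instance

theorem exists_map (f : X ⟶ B) : ∃ (fE : M.E ⟶ N.E) (fZ : M.Z ⟶ N.Z),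
    M.e ≫ fE = f.app _ ≫ N.e ∧ M.z ≫ fZ = f.app _ ≫ N.z ∧
      fE ≫ N.s = M.s ≫ fZ ∧ fE ≫ N.t = M.t ≫ fZ := by
  obtain ⟨fZ, hZ⟩ := exists_extension_of_anodyne M.anodyne_z (f.app _ ≫ N.z)
  have hs : (f.app _ ≫ N.e) ≫ N.s = M.e ≫ M.s ≫ fZ := by
    rw [Category.assoc, ← N.w_s, ← reassoc_of% M.w_s, hZ, SimplicialObject.δ_naturality_assoc]
  have ht : (f.app _ ≫ N.e) ≫ N.t = M.e ≫ M.t ≫ fZ := by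
    rw [Category.assoc, ← N.w_t, ← reassoc_of% M.w_t, hZ, SimplicialObject.δ_naturality_assoc]
  obtain ⟨fE, hE, hst⟩ := exists_lift_of_anodyne M.anodyne_e (prod.lift N.s N.t)
    (a := f.app _ ≫ N.e) (b := prod.lift (M.s ≫ fZ) (M.t ≫ fZ)) (by
      rw [prod.comp_lift, prod.comp_lift, hs, ht])
  refine ⟨fE, fZ, hE, hZ, ?_, ?_⟩
  · rw [← prod.lift_fst N.s N.t, reassoc_of% hst, prod.lift_fst]
  · rw [← prod.lift_snd N.s N.t, reassoc_of% hst, prod.lift_snd]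

theorem exists_segalMap {k : ℕ} (K : ChainLimit M.s M.t k) : ∃ σ : X _⦋k + 1⦌ ⟶ K.pt,
    ∀ a, σ ≫ K.π a = X.map (SimplexCategory.mkOfSucc a).op ≫ M.e :=
  K.exists_lift (fun a ↦ X.map (SimplexCategory.mkOfSucc a).op ≫ M.e) fun b ↦ by
    rw [Category.assoc, Category.assoc, ← M.w_s, ← M.w_t, ← Category.assoc, segal_comm,
      Category.assoc]

theorem isHomotopyLimit_segalCone_iff {k : ℕ} (K : ChainLimit M.s M.t k) {σ : X _⦋k + 1⦌ ⟶ K.pt}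
    (hσ : ∀ a, σ ≫ K.π a = X.map (SimplexCategory.mkOfSucc a).op ≫ M.e) :
    IsHomotopyLimit (segalCone X k) ↔ IsWeakEquivalence σ := by
  let η : (segalDiagram X k).multicospan ⟶ (chainIndex M.s M.t k).multicospan :=
    { app := fun j ↦ match j with
        | .left _ => M.e
        | .right _ => M.z
      naturality := by
        rintro _ _ (_ | b | b)
        · rw [WalkingMulticospan.Hom.id_eq_id, CategoryTheory.Functor.map_id,
            CategoryTheory.Functor.map_id, Category.id_comp, Category.comp_id]
        · exact M.w_t
        · exact M.w_s }
  refine isHomotopyLimit_iff η ?_ (isInjectivelyFibrant_chain M.s M.t k) K.isLimit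
    (segalCone X k) ?_
  · rintro (_ | _)
    exacts [M.isWeakEquivalence_e, M.isWeakEquivalence_z]
  · rintro (a | b)
    · exact hσ a
    · have : σ ≫ K.π b.castSucc ≫ M.t =
          (X.map (SimplexCategory.mkOfSucc b.castSucc).op ≫ X.δ 0) ≫ M.z := by
        rw [reassoc_of% hσ, Category.assoc, M.w_t]
      exact this

end SourceTargetModel

theorem map_mkOfSucc_zero_δ_one (X : SimplicialObject SSet.{u}) (k : ℕ) :
    X.map (SimplexCategory.mkOfSucc (0 : Fin (k + 1))).op ≫ X.δ 1 =
      X.map (SimplexCategory.const ⦋0⦌ ⦋k + 1⦌ 0).op := by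
  rw [SimplicialObject.δ, ← X.map_comp, ← op_comp, SimplexCategory.δ_one_mkOfSucc,
    Fin.castSucc_zero]

theorem const_zero_comp_δ_last (n : ℕ) :
    SimplexCategory.const ⦋0⦌ ⦋n⦌ 0 ≫ SimplexCategory.δ (Fin.last (n + 1)) =
      SimplexCategory.const ⦋0⦌ ⦋n + 1⦌ 0 := by
  rw [SimplexCategory.const_comp]
  congr 1

theorem const_zero_one_eq_δ :
    SimplexCategory.const ⦋0⦌ ⦋1⦌ 0 = SimplexCategory.δ (n := 0) 1 := by
  rw [← const_zero_comp_δ_last, SimplexCategory.const_eq_id, Category.id_comp]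
  rfl

variable {X B : SimplicialObject SSet.{u}} (f : X ⟶ B)

/-- If the source map of `X` is the homotopy pullback of the source map of `B`, then the Segal map
of `X` is a weak equivalence in the degrees in which the first vertex map is homotopy cartesian. -/
theorem isHomotopyLimit_segalCone_iff
    (hf : IsHomotopyCartesianAlong f (SimplexCategory.δ (n := 0) 1)) {k : ℕ}
    (hB : IsHomotopyLimit (segalCone B k)) :
    IsHomotopyLimit (segalCone X k) ↔
      IsHomotopyCartesianAlong f (SimplexCategory.const ⦋0⦌ ⦋k + 1⦌ 0) := by
  obtain ⟨M⟩ := SourceTargetModel.nonempty X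
  obtain ⟨N⟩ := SourceTargetModel.nonempty B
  obtain ⟨fE, fZ, hE, hZ, hs, ht⟩ := M.exists_map N f
  obtain ⟨K⟩ := ChainLimit.nonempty M.s M.t k
  obtain ⟨L⟩ := ChainLimit.nonempty N.s N.t k
  obtain ⟨σ, hσ⟩ := M.exists_segalMap K
  obtain ⟨τ, hτ⟩ := N.exists_segalMap L
  rw [N.isHomotopyLimit_segalCone_iff L hτ] at hB
  rw [M.isHomotopyLimit_segalCone_iff K hσ]
  have := L.fibration_source
  obtain ⟨P, p₁, p₂, sq⟩ : ∃ (P : SSet.{u}) (p₁ : P ⟶ M.Z) (p₂ : P ⟶ L.pt),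
    IsPullback p₁ p₂ fZ (L.π 0 ≫ N.s) := ⟨_, _, _, .of_hasPullback _ _⟩
  obtain ⟨c, hc⟩ := L.exists_lift (fun a ↦ K.π a ≫ fE) (fun b ↦ by
    rw [Category.assoc, Category.assoc, ht, hs, reassoc_of% K.w b])
  obtain ⟨κ, hκ₁, hκ₂⟩ : ∃ κ : K.pt ⟶ P, κ ≫ p₁ = K.π 0 ≫ M.s ∧ κ ≫ p₂ = c := by
    refine ⟨sq.lift (K.π 0 ≫ M.s) c ?_, sq.lift_fst _ _ _, sq.lift_snd _ _ _⟩
    rw [reassoc_of% hc, hs, Category.assoc]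
  have hκ : IsWeakEquivalence κ := by
    refine ChainLimit.isWeakEquivalence_of_isPullback ht ?_ K L sq hκ₁
      (fun a ↦ by rw [reassoc_of% hκ₂, hc])
    intro Q q₁ q₂ sqQ
    refine ⟨sqQ.lift M.s fE hs.symm, sqQ.lift_fst _ _ _, sqQ.lift_snd _ _ _, ?_⟩
    rw [← M.isWeakEquivalence_e.comp_iff_right]
    refine (isHomotopyCartesian_iff _ M.isWeakEquivalence_z N.isWeakEquivalence_e
      N.isWeakEquivalence_z hZ.symm N.w_s sqQ ?_ ?_).1 hf
    · rw [Category.assoc, sqQ.lift_fst, ← M.w_s]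
      rfl
    · rw [Category.assoc, sqQ.lift_snd, hE]
  -- The composite `σ ≫ κ` is the comparison map of the first vertex square, with `B_{k+1}` replaced
  -- by `L.pt` along its Segal map `τ`.
  rw [← hκ.comp_iff_left]
  refine (isHomotopyCartesian_iff _ M.isWeakEquivalence_z hB N.isWeakEquivalence_z hZ.symm ?_ sq
    ?_ ?_).symm
  · rw [reassoc_of% hτ, ← N.w_s, ← map_mkOfSucc_zero_δ_one, Category.assoc]
  · rw [Category.assoc, hκ₁, reassoc_of% hσ, ← M.w_s, ← map_mkOfSucc_zero_δ_one, Category.assoc]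
  · rw [Category.assoc, hκ₂]
    apply L.hom_ext
    intro a
    rw [Category.assoc, Category.assoc, hc, hτ, reassoc_of% hσ, hE, f.naturality_assoc]

theorem isSegal_iff_isHomotopyCartesianAlong_const (hB : IsSegal B)
    (hf : IsHomotopyCartesianAlong f (SimplexCategory.δ (n := 0) 1)) :
    IsSegal X ↔ ∀ n : ℕ, 1 ≤ n →
      IsHomotopyCartesianAlong f (SimplexCategory.const ⦋0⦌ ⦋n⦌ 0) := by
  constructor
  · rintro hX (_ | _ | k) hk
    · exact absurd hk (by simp)
    -- There is no Segal condition for `n = 1`; the square is the one in `hf`.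
    · rwa [zero_add, const_zero_one_eq_δ]
    · exact (isHomotopyLimit_segalCone_iff f hf (hB _ (by lia))).1 (hX _ (by lia))
  · intro h k hk
    exact (isHomotopyLimit_segalCone_iff f hf (hB _ hk)).2 (h _ (by lia))

/-- The first vertex map of `X_{n+1}` is the last face followed by the first vertex map of `X_n`, so
the pasting law applies. -/
theorem isHomotopyCartesianAlong_const_succ_iff {n : ℕ}
    (h : IsHomotopyCartesianAlong f (SimplexCategory.const ⦋0⦌ ⦋n⦌ 0)) :
    IsHomotopyCartesianAlong f (SimplexCategory.const ⦋0⦌ ⦋n + 1⦌ 0) ↔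
      IsHomotopyCartesianAlong f (SimplexCategory.δ (Fin.last (n + 1))) := by
  refine isHomotopyCartesian_paste_iff _ _ _ ?_ ?_ h
  · rw [← X.map_comp, ← op_comp, const_zero_comp_δ_last]
  · rw [← B.map_comp, ← op_comp, const_zero_comp_δ_last]

end SegalSpaces

end SimplicialSpace

theorem mainTheorem10 {X B : SimplicialObject SSet.{u}} (f : X ⟶ B)
    (hB : SimplicialSpace.IsSegal B)
    (hf : SimplicialSpace.IsHomotopyCartesianAlong f (SimplexCategory.δ (n := 0) 1)) :
    List.TFAE [
      SimplicialSpace.IsSegal X,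
      SimplicialSpace.IsRightFibration f,
      ∀ n : ℕ, 1 ≤ n →
        SimplicialSpace.IsHomotopyCartesianAlong f (SimplexCategory.const ⦋0⦌ ⦋n⦌ 0),
      ∀ n : ℕ,
        SimplicialSpace.IsHomotopyCartesianAlong f
          (SimplexCategory.δ (n := n) (Fin.last (n + 1)))] := by
  tfae_have 1 ↔ 2 := ⟨fun h ↦ ⟨h, hf⟩, fun h ↦ h.1⟩
  tfae_have 1 ↔ 3 := SimplicialSpace.isSegal_iff_isHomotopyCartesianAlong_const f hB hf
  tfae_have 3 → 4 := by
    rintro h (_ | n)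
    -- For `n = 0` the last face is `d₁ : X₁ ⟶ X₀`, the source map.
    · exact hf
    · exact (SimplicialSpace.isHomotopyCartesianAlong_const_succ_iff f (h _ (by lia))).1
        (h _ (by lia))
  tfae_have 4 → 3 := by
    intro h n hn
    induction n, hn using Nat.le_induction with
    | base => rwa [SimplicialSpace.const_zero_one_eq_δ]
    | succ n _ ih =>
      exact (SimplicialSpace.isHomotopyCartesianAlong_const_succ_iff f ih).2 (h n)
  tfae_finish
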